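/- Let $(M,g)$ be a connected smooth Riemannian manifold of dimension $n$ (Hausdorff, second countable, without boundary), not necessarily complete. For $x\in M$ and an orthonormal basis $e_1,\dots,e_n$ of $T_xM$ put $R_{ijkl}=g(R(e_i,e_j)e_l,e_k)$, where $R(X,Y)=\nabla_X\nabla_Y-\nabla_Y\nabla_X-\nabla_{[X,Y]}$ (so that $R_{ijij}$ is the sectional curvature for $i\neq j$), and let $$\overline R\colon S^2(T_xM)\to S^2(T_xM),\qquad (\overline R(h))_{ij}=\sum_{k,l}R_{iklj}h_{kl}.$$ The curvature operator of the second kind at $x$ is the self-adjoint operator $\mathcal R=\operatorname{pr}_{S^2_0(T_xM)}\circ\overline R\colon S^2_0(T_xM)\to S^2_0(T_xM)$ on trace-free symmetric tensors. For an integer $k$, it is called $k$-nonnegative if its eigenvalues $\lambda_1\le\lambda_2\le\dots\le\lambda_N$, counted with multiplicity, satisfy $\lambda_1+\dots+\lambda_k\ge 0$ (for $k=n$ one has $k\le N$ unless $n=1$, when $N=0$ and the sum is empty), and $k$-nonpositive if $-\mathcal R$ is $k$-nonnegative. If $\mathcal R$ is $n$-nonnegative at every point of $M$, or $n$-nonpositive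 at every point of $M$, then $(M,g)$ is irreducible (for every $x\in M$ the restricted holonomy group, i.e. the group of parallel transports along null-homotopic piecewise $C^1$ loops at $x$, acts irreducibly on $T_xM$) or $(M,g)$ is flat (its curvature tensor vanishes identically). -/

import Mathlib

open scoped Manifold ContDiff Matrix

noncomputable section

namespace CurvII

/-! ### Riemannian metrics, local coordinates, Christoffel symbols, curvature -/

/-- A smooth Riemannian metric on the `n`-dimensional smooth manifold `M`
(without boundary, not necessarily complete). -/
abbrev RiemMetric (n : ℕ) (M : Type*) [TopologicalSpace M]
    [ChartedSpace (EuclideanSpace ℝ (Fin n)) M] [IsManifold (𝓡 n) ∞ M] :=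
  Bundle.ContMDiffRiemannianMetric (𝓡 n) ∞ (EuclideanSpace ℝ (Fin n))
    (fun x : M => TangentSpace (𝓡 n) x)

section Local

variable {n : ℕ} {M : Type*} [TopologicalSpace M]
  [ChartedSpace (EuclideanSpace ℝ (Fin n)) M] [IsManifold (𝓡 n) ∞ M]

/-- The coordinate vector field `∂ᵢ` of the chart at `c`, at the point with coordinates `y`. -/
def coordVec (c : M) (y : EuclideanSpace ℝ (Fin n)) (i : Fin n) :
    TangentSpace (𝓡 n) ((extChartAt (𝓡 n) c).symm y) :=
  mfderiv 𝓘(ℝ, EuclideanSpace ℝ (Fin n)) (𝓡 n) (extChartAt (𝓡 n) c).symm y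
    (EuclideanSpace.single i (1 : ℝ))

/-- The coordinates, in the chart at `c`, of a tangent vector `W = (p, v)`. -/
def vecCoord (c : M) (W : TangentBundle (𝓡 n) M) : EuclideanSpace ℝ (Fin n) :=
  mfderiv (𝓡 n) 𝓘(ℝ, EuclideanSpace ℝ (Fin n)) (extChartAt (𝓡 n) c) W.proj W.snd

/-- The matrix `g_{ij} = g(∂ᵢ, ∂ⱼ)` of the metric in the chart at `c`. -/
def gram (g : RiemMetric n M) (c : M) (y : EuclideanSpace ℝ (Fin n)) :
    Matrix (Fin n) (Fin n) ℝ :=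
  Matrix.of fun i j =>
    g.inner ((extChartAt (𝓡 n) c).symm y) (coordVec c y i) (coordVec c y j)

/-- The partial derivative `∂ᵢ f` of a function of the coordinates. -/
def pd (i : Fin n) (f : EuclideanSpace ℝ (Fin n) → ℝ) (y : EuclideanSpace ℝ (Fin n)) : ℝ :=
  fderiv ℝ f y (EuclideanSpace.single i (1 : ℝ))

/-- The Christoffel symbol `Γᵏᵢⱼ` of the Levi-Civita connection in the chart at `c`:
`Γᵏᵢⱼ = ½ ∑ₗ gᵏˡ (∂ᵢ gⱼₗ + ∂ⱼ gᵢₗ - ∂ₗ gᵢⱼ)`. -/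
def christoffel (g : RiemMetric n M) (c : M) (k i j : Fin n)
    (y : EuclideanSpace ℝ (Fin n)) : ℝ :=
  (1 / 2 : ℝ) * ∑ l, (gram g c y)⁻¹ k l *
    (pd i (fun z => gram g c z j l) y + pd j (fun z => gram g c z i l) y
      - pd l (fun z => gram g c z i j) y)

/-- The vector with components `∑ᵢⱼ Γᵏᵢⱼ uⁱ vʲ`. -/
def christoffelVec (g : RiemMetric n M) (c : M) (y u v : EuclideanSpace ℝ (Fin n)) :
    EuclideanSpace ℝ (Fin n) :=
  WithLp.toLp 2 fun k => ∑ i, ∑ j, christoffel g c k i j y * u i * v j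

/-- The component along `∂ₗ` of `R(∂ᵢ, ∂ⱼ) ∂ₖ`, where
`R(X, Y) Z = ∇_X ∇_Y Z - ∇_Y ∇_X Z - ∇_{[X, Y]} Z`. -/
def curvUp (g : RiemMetric n M) (c : M) (l k i j : Fin n)
    (y : EuclideanSpace ℝ (Fin n)) : ℝ :=
  pd i (christoffel g c l j k) y - pd j (christoffel g c l i k) y
    + ∑ m, (christoffel g c l i m y * christoffel g c m j k y
      - christoffel g c l j m y * christoffel g c m i k y)

/-- `R_{ijkl} = g(R(∂ᵢ, ∂ⱼ) ∂ₗ, ∂ₖ)`; with this sign `R_{ijij}` is positive on round spheres. -/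
def curvLow (g : RiemMetric n M) (c : M) (i j k l : Fin n)
    (y : EuclideanSpace ℝ (Fin n)) : ℝ :=
  ∑ m, gram g c y k m * curvUp g c m l i j y

/-- The Riemann curvature tensor `Rm(u, v, w, z) = g(R(u, v) z, w)` at `x`, computed in the
chart at `x`. -/
def riemannTensor (g : RiemMetric n M) (x : M) (u v w z : TangentSpace (𝓡 n) x) : ℝ :=
  ∑ i, ∑ j, ∑ k, ∑ l, curvLow g x i j k l (extChartAt (𝓡 n) x x)
    * vecCoord x ⟨x, u⟩ i * vecCoord x ⟨x, v⟩ j * vecCoord x ⟨x, w⟩ k * vecCoord x ⟨x, z⟩ l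

/-- `(M, g)` is flat: its curvature tensor vanishes identically. -/
def IsFlat (g : RiemMetric n M) : Prop :=
  ∀ (x : M) (u v w z : TangentSpace (𝓡 n) x), riemannTensor g x u v w z = 0

end Local

/-! ### The curvature operator of the second kind -/

/-- Trace-free symmetric matrices: the components, in an orthonormal frame, of the elements
of `S²₀(T_x M)`. -/
def Sym0 (n : ℕ) : Submodule ℝ (Matrix (Fin n) (Fin n) ℝ) where
  carrier := {h | hᵀ = h ∧ h.trace = 0}
  add_mem' := by
    rintro a b ⟨ha, ha'⟩ ⟨hb, hb'⟩
    exact ⟨by rw [Matrix.transpose_add, ha, hb], by rw [Matrix.trace_add, ha', hb', add_zero]⟩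
  zero_mem' := ⟨Matrix.transpose_zero, Matrix.trace_zero _ _⟩
  smul_mem' := by
    rintro r a ⟨ha, ha'⟩
    exact ⟨by rw [Matrix.transpose_smul, ha], by rw [Matrix.trace_smul, ha', smul_zero]⟩

/-- The formula for the orthogonal projection of a matrix to `Sym0 n`. -/
def proj0 (n : ℕ) (A : Matrix (Fin n) (Fin n) ℝ) : Matrix (Fin n) (Fin n) ℝ :=
  (1 / 2 : ℝ) • (A + Aᵀ) - (A.trace / n) • (1 : Matrix (Fin n) (Fin n) ℝ)

theorem proj0_mem (n : ℕ) (A : Matrix (Fin n) (Fin n) ℝ) : proj0 n A ∈ Sym0 n := by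
  refine ⟨?_, ?_⟩
  · simp [proj0, add_comm]
  · rcases Nat.eq_zero_or_pos n with rfl | hn
    · simp [Matrix.trace]
    · have : (n : ℝ) ≠ 0 := by positivity
      simp only [proj0, Matrix.trace_sub, Matrix.trace_smul, Matrix.trace_add,
        Matrix.trace_transpose, Matrix.trace_one, Fintype.card_fin, smul_eq_mul]
      field_simp
      ring

section Second

variable {n : ℕ} {M : Type*} [TopologicalSpace M]
  [ChartedSpace (EuclideanSpace ℝ (Fin n)) M] [IsManifold (𝓡 n) ∞ M]

/-- `e` is an orthonormal basis of `(T_x M, g_x)`. -/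
def IsOrthonormalFrame (g : RiemMetric n M) (x : M) (e : Fin n → TangentSpace (𝓡 n) x) : Prop :=
  ∀ i j, g.inner x (e i) (e j) = if i = j then 1 else 0

/-- The action `(R̄ h)ᵢⱼ = ∑ₖₗ R_{iklj} hₖₗ` in the frame `e`. -/
def rBar (g : RiemMetric n M) (x : M) (e : Fin n → TangentSpace (𝓡 n) x)
    (h : Matrix (Fin n) (Fin n) ℝ) : Matrix (Fin n) (Fin n) ℝ :=
  Matrix.of fun i j => ∑ k, ∑ l, riemannTensor g x (e i) (e k) (e l) (e j) * h k l

/-- The curvature operator of the second kind `pr ∘ R̄ : S²₀(T_x M) → S²₀(T_x M)`, in the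
orthonormal frame `e`. -/
def curvOpII (g : RiemMetric n M) (x : M) (e : Fin n → TangentSpace (𝓡 n) x) :
    Sym0 n →ₗ[ℝ] Sym0 n where
  toFun h := ⟨proj0 n (rBar g x e h), proj0_mem n _⟩
  map_add' a b := by
    have : rBar g x e ((a + b : Sym0 n) : Matrix (Fin n) (Fin n) ℝ)
        = rBar g x e a + rBar g x e b := by
      ext i j
      simp [rBar, mul_add, Finset.sum_add_distrib]
    apply Subtype.ext
    change proj0 n (rBar g x e ((a + b : Sym0 n) : Matrix (Fin n) (Fin n) ℝ))
      = proj0 n (rBar g x e a) + proj0 n (rBar g x e b)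
    rw [this]
    simp only [proj0, Matrix.transpose_add, Matrix.trace_add]
    module
  map_smul' r a := by
    have : rBar g x e ((r • a : Sym0 n) : Matrix (Fin n) (Fin n) ℝ) = r • rBar g x e a := by
      ext i j
      simp [rBar, Finset.mul_sum, mul_left_comm]
    apply Subtype.ext
    change proj0 n (rBar g x e ((r • a : Sym0 n) : Matrix (Fin n) (Fin n) ℝ))
      = r • proj0 n (rBar g x e a)
    rw [this]
    simp only [proj0, Matrix.transpose_smul, Matrix.trace_smul, smul_eq_mul]
    module

end Second

/-- A (self-adjoint) operator `T` on `S²₀` is `k`-nonnegative: its eigenvalues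
`λ₁ ≤ λ₂ ≤ ⋯ ≤ λ_N`, listed with multiplicity by means of an orthonormal eigenbasis, satisfy
`λ₁ + ⋯ + λₖ ≥ 0`. -/
def IsKNonneg {n : ℕ} (k : ℕ) (T : Sym0 n →ₗ[ℝ] Sym0 n) : Prop :=
  ∃ (S : Fin (Module.finrank ℝ (Sym0 n)) → Sym0 n)
    (eig : Fin (Module.finrank ℝ (Sym0 n)) → ℝ),
    (∀ a b, ∑ i, ∑ j, (S a : Matrix (Fin n) (Fin n) ℝ) i j * (S b : Matrix (Fin n) (Fin n) ℝ) i j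
      = if a = b then 1 else 0) ∧
    (∀ a, T (S a) = eig a • S a) ∧
    Monotone eig ∧
    0 ≤ ∑ a with a.val < k, eig a

section Main

variable {n : ℕ} {M : Type*} [TopologicalSpace M]
  [ChartedSpace (EuclideanSpace ℝ (Fin n)) M] [IsManifold (𝓡 n) ∞ M]

/-- The curvature operator of the second kind of `(M, g)` is `k`-nonnegative (at every point).
The eigenvalues do not depend on the orthonormal frame. -/
def CurvIINonneg (g : RiemMetric n M) (k : ℕ) : Prop :=
  ∀ x : M, ∃ e : Fin n → TangentSpace (𝓡 n) x,
    IsOrthonormalFrame g x e ∧ IsKNonneg k (curvOpII g x e)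

/-- The curvature operator of the second kind of `(M, g)` is `k`-nonpositive: its negative is
`k`-nonnegative (at every point). -/
def CurvIINonpos (g : RiemMetric n M) (k : ℕ) : Prop :=
  ∀ x : M, ∃ e : Fin n → TangentSpace (𝓡 n) x,
    IsOrthonormalFrame g x e ∧ IsKNonneg k (-curvOpII g x e)

/-! ### Parallel transport, restricted holonomy, irreducibility -/

/-- The curve `W` of tangent vectors is, on `[a, b]`, a parallel field along its base curve
`y = proj ∘ W`: in each chart, `v' + Γ(y', v) = 0` (one-sided derivatives at `a` and `b`). -/
def IsParallelOn (g : RiemMetric n M) (W : ℝ → TangentBundle (𝓡 n) M) (a b : ℝ) : Prop :=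
  ∀ t ∈ Set.Icc a b, ∀ c : M, (W t).proj ∈ (chartAt (EuclideanSpace ℝ (Fin n)) c).source →
    HasDerivWithinAt (fun s => vecCoord c (W s))
      (-christoffelVec g c (extChartAt (𝓡 n) c (W t).proj)
        (derivWithin (fun s => extChartAt (𝓡 n) c (W s).proj) (Set.Icc a b) t)
        (vecCoord c (W t)))
      (Set.Icc a b) t

/-- The path `γ` is piecewise `C¹` and `w` is the parallel transport of `v` along `γ`. -/
def IsParallelTransport (g : RiemMetric n M) {p q : M} (γ : Path p q)
    (v : TangentSpace (𝓡 n) p) (w : TangentSpace (𝓡 n) q) : Prop :=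
  ∃ W : ℝ → TangentBundle (𝓡 n) M,
    (∀ s ∈ Set.Icc (0 : ℝ) 1, (W s).proj = γ.extend s) ∧ W 0 = ⟨p, v⟩ ∧ W 1 = ⟨q, w⟩ ∧
    ∃ (m : ℕ) (t : ℕ → ℝ), Monotone t ∧ t 0 = 0 ∧ t m = 1 ∧
      ∀ i < m, ContMDiffOn 𝓘(ℝ, ℝ) (𝓡 n) 1 γ.extend (Set.Icc (t i) (t (i + 1))) ∧
        IsParallelOn g W (t i) (t (i + 1))

/-- The restricted holonomy group of `(M, g)` at `x`: the parallel transports along the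
null-homotopic piecewise `C¹` loops at `x`. -/
def restrictedHolonomy (g : RiemMetric n M) (x : M) :
    Set (TangentSpace (𝓡 n) x →ₗ[ℝ] TangentSpace (𝓡 n) x) :=
  {P | ∃ γ : Path x x, γ.Homotopic (Path.refl x) ∧ ∀ v, IsParallelTransport g γ v (P v)}

/-- `(M, g)` is irreducible: its restricted holonomy group acts irreducibly on the tangent
spaces. -/
def IsIrreducible (g : RiemMetric n M) : Prop :=
  ∀ x : M, Nontrivial (TangentSpace (𝓡 n) x) ∧
    ∀ V : Submodule ℝ (TangentSpace (𝓡 n) x),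
      (∀ P ∈ restrictedHolonomy g x, ∀ v ∈ V, P v ∈ V) → V = ⊥ ∨ V = ⊤

end Main

end CurvII

end

noncomputable section

set_option linter.unusedSectionVars false
set_option maxSynthPendingDepth 3

namespace CurvII

/-! ### Sums of lowest eigenvalues -/

/-! Suppose the restricted holonomy at one point preserves a proper nonzero subspace. The proof has
a geometric half, which turns this into a curvature-invariant subspace at every point, and an
algebraic half, which shows that such a curvature tensor vanishes.

Geometry. Conjugating null-homotopic loops by a path carries invariant subspaces from point to
point, and a clopen argument spreads them over the connected manifold
(`hasInvariantSubspace_of_connected`). In a small convex coordinate set, the metric projection onto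
the invariant subspace at a base point is carried along straight segments. A triangle of segments is
a null-homotopic loop, and its transport is an isometry preserving the subspace, so it commutes with
the projection; hence the transported field `p` is compatible with transport along every segment.
Therefore `dp = [p, Γ]`, and symmetry of the second derivative of `p` says that `p` commutes with
all `R(u, v)` (`IsSmall.commute_curvVec`, `IsSmall.exists_curvVec_invariant`). Only this easy
direction of the relation between holonomy and curvature is needed.

Algebra (`IsAlgCurv.eq_zero_of_reducible`). Let `V` be invariant, of dimension `p`, with orthogonal
complement `W` of dimension `q`, so `p + q = n`. All mixed curvature components vanish, so the
quadratic form of the operator is zero on the `pq` orthogonal tensors `v ⊙ w`. Since `pq ≥ n - 1`,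
an `n`-nonnegative operator must be nonnegative on everything orthogonal to them
(`IsKNonneg.frob_nonneg_of_orthogonal`). Testing with `a ⊙ b` inside `V` or inside `W` gives
nonnegative sectional curvatures there; testing with `q id_V - p id_W` gives `-(q² scal_V + p²
scal_W) ≥ 0`. So both scalar curvatures are zero, hence the sectional curvatures are, hence the
tensor is. The nonpositive case is the same statement for the negated tensor. -/

theorem sum_mul_nonneg_of_sum_lowest_nonneg {N k : ℕ} (hk : 1 ≤ k) (w eig : Fin N → ℝ)
    (hw0 : ∀ a, 0 ≤ w a) (hw1 : ∀ a, w a ≤ 1) (hmono : Monotone eig)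
    (hsum : (k : ℝ) ≤ ∑ a, w a) (heig : 0 ≤ ∑ a with a.val < k, eig a) :
    0 ≤ ∑ a, w a * eig a := by
  have hkN : k ≤ N := by
    have h1 : ∑ a, w a ≤ ∑ _a : Fin N, (1 : ℝ) := Finset.sum_le_sum fun a _ => hw1 a
    simp only [Finset.sum_const, Finset.card_univ, Fintype.card_fin, nsmul_eq_mul, mul_one] at h1
    exact_mod_cast hsum.trans h1
  have hcard : (Finset.univ.filter fun a : Fin N => a.val < k).card = k := by
    rw [Fin.card_filter_val_lt]; omega
  -- `eig m` is the largest of the `k` lowest values, so it dominates their mean and is nonnegative;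
  -- it serves as the threshold in `key`.
  set m : Fin N := ⟨k - 1, by omega⟩ with hm
  have hlow : ∀ a : Fin N, a.val < k → eig a ≤ eig m := fun a ha =>
    hmono (Fin.le_def.2 (by simp [hm]; omega))
  have hhigh : ∀ a : Fin N, ¬ a.val < k → eig m ≤ eig a := fun a ha =>
    hmono (Fin.le_def.2 (by simp [hm]; omega))
  have hm0 : 0 ≤ eig m := by
    have h1 : ∑ a with a.val < k, eig a ≤ ∑ a : Fin N with a.val < k, eig m :=
      Finset.sum_le_sum fun a ha => hlow a (Finset.mem_filter.1 ha).2
    rw [Finset.sum_const, hcard, nsmul_eq_mul] at h1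
    have hk' : (0 : ℝ) < k := by exact_mod_cast hk
    by_contra hneg
    push Not at hneg
    nlinarith [mul_neg_of_pos_of_neg hk' hneg]
  -- Moving weight away from the lowest `k` places moves it past the threshold `eig m`, which can
  -- only increase the weighted sum. Any weight beyond `k` in total is counted with `eig m ≥ 0`.
  have key : ∀ a, (if a.val < k then eig a else 0) + (w a - if a.val < k then 1 else 0) * eig m
      ≤ w a * eig a := by
    intro a
    split_ifs with h
    · nlinarith [hlow a h, hw1 a]
    · nlinarith [hhigh a h, hw0 a]
  have h2 := Finset.sum_le_sum fun a (_ : a ∈ Finset.univ) => key a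
  rw [Finset.sum_add_distrib, ← Finset.sum_filter, ← Finset.sum_mul, Finset.sum_sub_distrib,
    ← Finset.sum_filter, Finset.sum_const, hcard] at h2
  simp only [nsmul_eq_mul, mul_one] at h2
  nlinarith [mul_nonneg (sub_nonneg.2 hsum) hm0]

/-- The Frobenius inner product of matrices. -/
def frob {n : ℕ} (A B : Matrix (Fin n) (Fin n) ℝ) : ℝ := ∑ i, ∑ j, A i j * B i j

/-- The isometric embedding of `Sym0 n` in a Euclidean space. -/
def symEmb (n : ℕ) : Sym0 n →ₗ[ℝ] EuclideanSpace ℝ (Fin n × Fin n) where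
  toFun A := WithLp.toLp 2 fun p => (A : Matrix (Fin n) (Fin n) ℝ) p.1 p.2
  map_add' A B := by ext; simp
  map_smul' r A := by ext; simp

theorem inner_symEmb {n : ℕ} (A B : Sym0 n) : inner ℝ (symEmb n A) (symEmb n B) = frob A.1 B.1 := by
  simp only [symEmb, PiLp.inner_apply, frob, Fintype.sum_prod_type, LinearMap.coe_mk, AddHom.coe_mk]
  simp [mul_comm]

theorem symEmb_injective (n : ℕ) : Function.Injective (symEmb n) := by
  intro A B h
  ext i j
  exact congrFun (congrArg WithLp.ofLp h) (i, j)

/-- Ky Fan's principle: expanded in the eigenbasis, the partial trace is a weighted sum of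
eigenvalues. The weights are at most 1 by Bessel's inequality and add up to the number of vectors.
-/
theorem IsKNonneg.sum_frob_nonneg {n k : ℕ} (hk : 1 ≤ k) {T : Sym0 n →ₗ[ℝ] Sym0 n}
    (hT : IsKNonneg k T) {ι : Type*} [Fintype ι] [DecidableEq ι] (u : ι → Sym0 n)
    (hu : ∀ a b, frob (u a).1 (u b).1 = if a = b then 1 else 0) (hc : k ≤ Fintype.card ι) :
    0 ≤ ∑ i, frob (T (u i)).1 (u i).1 := by
  obtain ⟨S, eig, hS, hTS, hmono, hsum⟩ := hT
  have hSo : Orthonormal ℝ fun a => symEmb n (S a) := by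
    rw [orthonormal_iff_ite]
    intro a b
    rw [inner_symEmb]; exact hS a b
  have huo : Orthonormal ℝ fun a => symEmb n (u a) := by
    rw [orthonormal_iff_ite]
    intro a b
    rw [inner_symEmb]; exact hu a b
  have hli : LinearIndependent ℝ S :=
    LinearIndependent.of_comp (symEmb n) (v := S) hSo.linearIndependent
  have hspan : Submodule.span ℝ (Set.range S) = ⊤ :=
    hli.span_eq_top_of_card_eq_finrank' (by simp)
  set c : ι → Fin (Module.finrank ℝ (Sym0 n)) → ℝ :=
    fun i a => inner ℝ (symEmb n (S a)) (symEmb n (u i)) with hc'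
  have hexp : ∀ i, u i = ∑ a, c i a • S a := by
    intro i
    have hmem : u i ∈ Submodule.span ℝ (Set.range S) := hspan ▸ Submodule.mem_top
    obtain ⟨d, hd⟩ := (Submodule.mem_span_range_iff_exists_fun ℝ).1 hmem
    have : ∀ a, c i a = d a := by
      intro a
      simp only [hc', ← hd, map_sum, map_smul]
      exact hSo.inner_right_fintype d a
    rw [← hd]
    exact Finset.sum_congr rfl fun a _ => by rw [this a]
  have hTu : ∀ i, frob (T (u i)).1 (u i).1 = ∑ a, c i a ^ 2 * eig a := by
    intro i
    have h1 : T (u i) = ∑ a, (c i a * eig a) • S a := by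
      conv_lhs => rw [hexp i]
      simp [hTS, smul_smul]
    rw [← inner_symEmb, h1]
    simp only [map_sum, map_smul, sum_inner, inner_smul_left, RCLike.conj_to_real]
    refine Finset.sum_congr rfl fun a _ => ?_
    change c i a * eig a * c i a = _
    ring
  have hnorm : ∀ i, ∑ a, c i a ^ 2 = 1 := by
    intro i
    have h1 : frob (u i).1 (u i).1 = 1 := by simpa using hu i i
    rw [← inner_symEmb] at h1
    rw [← h1]
    nth_rw 1 [hexp i]
    simp only [map_sum, map_smul, sum_inner, inner_smul_left, RCLike.conj_to_real]
    refine Finset.sum_congr rfl fun a _ => ?_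
    change _ = c i a * c i a
    ring
  have hbessel : ∀ a, ∑ i, c i a ^ 2 ≤ 1 := by
    intro a
    have h1 := huo.sum_inner_products_le (symEmb n (S a)) (s := Finset.univ)
    rw [hSo.1 a] at h1
    simpa [hc', real_inner_comm] using h1
  simp_rw [hTu]
  rw [Finset.sum_comm]
  simp_rw [← Finset.sum_mul]
  refine sum_mul_nonneg_of_sum_lowest_nonneg hk _ eig
    (fun a => Finset.sum_nonneg fun i _ => sq_nonneg _) hbessel hmono ?_ hsum
  rw [Finset.sum_comm]
  simp_rw [hnorm]
  simpa using hc

theorem frob_comm {n : ℕ} (A B : Matrix (Fin n) (Fin n) ℝ) : frob A B = frob B A := by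
  simp only [frob, mul_comm]

theorem frob_smul_left {n : ℕ} (r : ℝ) (A B : Matrix (Fin n) (Fin n) ℝ) :
    frob (r • A) B = r * frob A B := by
  simp only [frob, Finset.mul_sum, Matrix.smul_apply, smul_eq_mul, mul_assoc]

theorem frob_smul_right {n : ℕ} (r : ℝ) (A B : Matrix (Fin n) (Fin n) ℝ) :
    frob A (r • B) = r * frob A B := by
  rw [frob_comm, frob_smul_left, frob_comm]

theorem frob_self_pos {n : ℕ} {A : Sym0 n} (hA : A ≠ 0) : 0 < frob A.1 A.1 := by
  rw [← inner_symEmb, real_inner_self_eq_norm_sq]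
  have : symEmb n A ≠ 0 := fun h => hA (symEmb_injective n (by simpa using h))
  positivity

/-- A `k`-nonnegative operator whose quadratic form vanishes on an orthogonal family with at least
`k - 1` members is nonnegative on the orthogonal complement of that family. -/
theorem IsKNonneg.frob_nonneg_of_orthogonal {n k : ℕ} (hk : 1 ≤ k) {T : Sym0 n →ₗ[ℝ] Sym0 n}
    (hT : IsKNonneg k T) {ι : Type*} [Fintype ι] [DecidableEq ι] (m : ι → Sym0 n)
    (hm0 : ∀ a, m a ≠ 0) (hm : ∀ a b, a ≠ b → frob (m a).1 (m b).1 = 0)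
    (hTm : ∀ a, frob (T (m a)).1 (m a).1 = 0) (hc : k ≤ Fintype.card ι + 1)
    (h : Sym0 n) (hh : ∀ a, frob h.1 (m a).1 = 0) : 0 ≤ frob (T h).1 h.1 := by
  rcases eq_or_ne h 0 with rfl | h0
  · simp [frob]
  set N : Sym0 n → Sym0 n := fun A => (Real.sqrt (frob A.1 A.1))⁻¹ • A with hN
  have hNN : ∀ A B : Sym0 n, frob (N A).1 (N B).1
      = (Real.sqrt (frob A.1 A.1))⁻¹ * ((Real.sqrt (frob B.1 B.1))⁻¹ * frob A.1 B.1) := by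
    intro A B
    rw [hN]
    simp only [Submodule.coe_smul, frob_smul_left, frob_smul_right]
    ring
  have hone : ∀ A : Sym0 n, A ≠ 0 → frob (N A).1 (N A).1 = 1 := by
    intro A hA
    have h1 := frob_self_pos hA
    rw [hNN, ← mul_assoc, ← mul_inv, Real.mul_self_sqrt h1.le, inv_mul_cancel₀ h1.ne']
  have hTN : ∀ A : Sym0 n, frob (T (N A)).1 (N A).1
      = (Real.sqrt (frob A.1 A.1))⁻¹ ^ 2 * frob (T A).1 A.1 := by
    intro A
    rw [hN]
    simp only [map_smul, Submodule.coe_smul, frob_smul_left, frob_smul_right]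
    ring
  -- Adjoining `h` to the family gives at least `k` orthogonal tensors; in the partial trace only
  -- the term of `h` survives.
  have key := hT.sum_frob_nonneg hk (ι := Option ι) (fun o => N (o.elim h m)) (by
    rintro (_ | a) (_ | b)
    · simpa using hone h h0
    · simp [hNN, hh]
    · simp [hNN, frob_comm (m a).1, hh]
    · by_cases hab : a = b
      · subst hab; simpa using hone _ (hm0 a)
      · simp [hNN, hm a b hab, hab]) (by simpa using hc)
  rw [Fintype.sum_option] at key
  simp only [Option.elim, hTN, hTm, mul_zero, Finset.sum_const_zero, add_zero] at key
  have h1 := Real.sqrt_pos.2 (frob_self_pos h0)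
  exact nonneg_of_mul_nonneg_right key (by positivity)

/-! ### Algebraic curvature tensors -/

/-- The symmetries of a Riemann curvature tensor in components. -/
structure IsAlgCurv {n : ℕ} (r : Fin n → Fin n → Fin n → Fin n → ℝ) : Prop where
  anti_left : ∀ i j k l, r i j k l = -r j i k l
  anti_right : ∀ i j k l, r i j k l = -r i j l k
  bianchi : ∀ i j k l, r i j k l + r j k i l + r k i j l = 0

/-- The classical octahedron argument: combine the four Bianchi identities obtained by rotating the
indices and cancel with the two skew symmetries. -/
theorem IsAlgCurv.pair {n : ℕ} {r : Fin n → Fin n → Fin n → Fin n → ℝ} (h : IsAlgCurv r)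
    (i j k l : Fin n) : r i j k l = r k l i j := by
  have b1 := h.bianchi i j k l
  have b2 := h.bianchi j k l i
  have b3 := h.bianchi k l i j
  have b4 := h.bianchi l i j k
  linarith [h.anti_right j k l i, h.anti_right k l j i, h.anti_left k l j i, h.anti_right l j k i,
    h.anti_left k l i j, h.anti_right l i k j, h.anti_left i k l j, h.anti_right i k l j,
    h.anti_left l i j k, h.anti_right i j l k, h.anti_left j l i k, h.anti_right j l i k,
    h.anti_right k i j l, h.anti_right l i j k, h.anti_left i l k j, h.anti_left k i j l,
    h.anti_left j k i l, h.anti_left l j k i, h.anti_right i k j l, h.anti_right l j i k,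
    h.anti_right j k i l]

/-- The quadrilinear form with components `r`. -/
def quad {n : ℕ} (r : Fin n → Fin n → Fin n → Fin n → ℝ) (a b c d : EuclideanSpace ℝ (Fin n)) : ℝ :=
  ∑ i, ∑ j, ∑ k, ∑ l, r i j k l * a i * b j * c k * d l

section quad

variable {n : ℕ} (r : Fin n → Fin n → Fin n → Fin n → ℝ)
  (a a' b b' c c' d d' : EuclideanSpace ℝ (Fin n)) (s : ℝ)

theorem quad_add_fst : quad r (a + a') b c d = quad r a b c d + quad r a' b c d := by
  simp only [quad, PiLp.add_apply, mul_add, add_mul, Finset.sum_add_distrib]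

theorem quad_add_snd : quad r a (b + b') c d = quad r a b c d + quad r a b' c d := by
  simp only [quad, PiLp.add_apply, mul_add, add_mul, Finset.sum_add_distrib]

theorem quad_add_trd : quad r a b (c + c') d = quad r a b c d + quad r a b c' d := by
  simp only [quad, PiLp.add_apply, mul_add, add_mul, Finset.sum_add_distrib]

theorem quad_add_fth : quad r a b c (d + d') = quad r a b c d + quad r a b c d' := by
  simp only [quad, PiLp.add_apply, mul_add, Finset.sum_add_distrib]

theorem quad_smul_fst : quad r (s • a) b c d = s * quad r a b c d := by
  simp only [quad, PiLp.smul_apply, smul_eq_mul, Finset.mul_sum]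
  congr! 4; ring

theorem quad_smul_snd : quad r a (s • b) c d = s * quad r a b c d := by
  simp only [quad, PiLp.smul_apply, smul_eq_mul, Finset.mul_sum]
  congr! 4; ring

theorem quad_smul_trd : quad r a b (s • c) d = s * quad r a b c d := by
  simp only [quad, PiLp.smul_apply, smul_eq_mul, Finset.mul_sum]
  congr! 4; ring

theorem quad_smul_fth : quad r a b c (s • d) = s * quad r a b c d := by
  simp only [quad, PiLp.smul_apply, smul_eq_mul, Finset.mul_sum]
  congr! 4; ring

variable {r}

theorem IsAlgCurv.quad_anti_left (h : IsAlgCurv r) : quad r a b c d = -quad r b a c d := by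
  simp only [quad]
  rw [Finset.sum_comm, ← Finset.sum_neg_distrib]
  simp only [← Finset.sum_neg_distrib]
  congr! 4 with i _ j _ k _ l _
  rw [h.anti_left]; ring

theorem IsAlgCurv.quad_anti_right (h : IsAlgCurv r) : quad r a b c d = -quad r a b d c := by
  simp only [quad, ← Finset.sum_neg_distrib]
  congr! 2 with i _ j _
  rw [Finset.sum_comm]
  congr! 2 with k _ l _
  rw [h.anti_right]; ring

theorem IsAlgCurv.quad_pair (h : IsAlgCurv r) : quad r a b c d = quad r c d a b := by
  simp only [quad]
  rw [Finset.sum_congr rfl fun i _ => Finset.sum_comm, Finset.sum_comm]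
  refine Finset.sum_congr rfl fun k _ => ?_
  rw [Finset.sum_congr rfl fun i _ => Finset.sum_congr rfl fun j _ => rfl]
  rw [Finset.sum_congr rfl fun i _ => Finset.sum_comm, Finset.sum_comm]
  congr! 3 with l _ i _ j _
  rw [h.pair]; ring

theorem IsAlgCurv.quad_bianchi (h : IsAlgCurv r) :
    quad r a b c d + quad r b c a d + quad r c a b d = 0 := by
  have h1 : quad r b c a d = ∑ i, ∑ j, ∑ k, ∑ l, r j k i l * a i * b j * c k * d l := by
    simp only [quad]
    rw [Finset.sum_congr rfl fun i _ => Finset.sum_comm, Finset.sum_comm]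
    congr! 4; ring
  have h2 : quad r c a b d = ∑ i, ∑ j, ∑ k, ∑ l, r k i j l * a i * b j * c k * d l := by
    simp only [quad]
    rw [Finset.sum_comm, Finset.sum_congr rfl fun i _ => Finset.sum_comm]
    congr! 4; ring
  rw [h1, h2, quad]
  simp only [← Finset.sum_add_distrib]
  refine Finset.sum_eq_zero fun i _ => Finset.sum_eq_zero fun j _ => Finset.sum_eq_zero fun k _ =>
    Finset.sum_eq_zero fun l _ => ?_
  rw [← add_mul, ← add_mul, ← add_mul, ← add_mul, ← add_mul, ← add_mul, ← add_mul, ← add_mul,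
    h.bianchi]
  ring

theorem IsAlgCurv.quad_self_left (h : IsAlgCurv r) : quad r a a c d = 0 := by
  linarith [h.quad_anti_left a a c d]

theorem quad_single (i j k l : Fin n) :
    quad r (EuclideanSpace.single i 1) (EuclideanSpace.single j 1) (EuclideanSpace.single k 1)
      (EuclideanSpace.single l 1) = r i j k l := by
  simp [quad]

theorem IsAlgCurv.neg (h : IsAlgCurv r) : IsAlgCurv fun i j k l => -r i j k l where
  anti_left i j k l := by rw [h.anti_left]
  anti_right i j k l := by rw [h.anti_right]
  bianchi i j k l := by linarith [h.bianchi i j k l]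

end quad

/-! ### Reducible curvature tensors -/

section Reducible

variable {n : ℕ} {r : Fin n → Fin n → Fin n → Fin n → ℝ}

/-- The quadratic form of `R̄` on matrices. -/
def rForm (r : Fin n → Fin n → Fin n → Fin n → ℝ) (h : Matrix (Fin n) (Fin n) ℝ) : ℝ :=
  ∑ i, ∑ j, (∑ k, ∑ l, r i k l j * h k l) * h i j

/-- The matrix `∑ₛ xₛ yₛᵀ`. -/
def outerSum {ι : Type*} [Fintype ι] (x y : ι → EuclideanSpace ℝ (Fin n)) :
    Matrix (Fin n) (Fin n) ℝ :=
  Matrix.of fun i j => ∑ s, x s i * y s j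

/-- Both kinds of test tensors used below, `a ⊙ b` and the weighted combination of two projections,
are sums of outer products, so this evaluates the form on each of them. -/
theorem rForm_outerSum {ι : Type*} [Fintype ι] (x y : ι → EuclideanSpace ℝ (Fin n)) :
    rForm r (outerSum x y) = ∑ s, ∑ t, quad r (x s) (x t) (y t) (y s) := by
  have h1 : ∀ s t, quad r (x s) (x t) (y t) (y s)
      = ∑ i, ∑ j, ∑ k, ∑ l, r i k l j * (x t k * y t l) * (x s i * y s j) := by
    intro s t
    simp only [quad]
    refine Finset.sum_congr rfl fun i _ => ?_
    rw [Finset.sum_congr rfl fun j _ => Finset.sum_comm, Finset.sum_comm]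
    congr! 3; ring
  simp only [h1, rForm, outerSum, Matrix.of_apply, Finset.mul_sum, Finset.sum_mul]
  have sw : ∀ f : ι → ι → Fin n → Fin n → Fin n → Fin n → ℝ,
      ∑ s, ∑ t, ∑ i, ∑ j, ∑ k, ∑ l, f s t i j k l = ∑ i, ∑ j, ∑ k, ∑ l, ∑ s, ∑ t, f s t i j k l := by
    intro f
    have e1 : ∀ g : ι → Fin n → Fin n → Fin n → Fin n → ℝ,
        ∑ s, ∑ i, ∑ j, ∑ k, ∑ l, g s i j k l = ∑ i, ∑ j, ∑ k, ∑ l, ∑ s, g s i j k l := by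
      intro g
      rw [Finset.sum_comm]; refine Finset.sum_congr rfl fun i _ => ?_
      rw [Finset.sum_comm]; refine Finset.sum_congr rfl fun i _ => ?_
      rw [Finset.sum_comm]; refine Finset.sum_congr rfl fun i _ => ?_
      rw [Finset.sum_comm]
    simp_rw [e1]
  rw [sw]
  refine Finset.sum_congr rfl fun i _ => Finset.sum_congr rfl fun j _ => ?_
  rw [Finset.sum_comm]; refine Finset.sum_congr rfl fun k _ => ?_
  rw [Finset.sum_comm]

theorem frob_outerSum {ι κ : Type*} [Fintype ι] [Fintype κ]
    (x y : ι → EuclideanSpace ℝ (Fin n)) (x' y' : κ → EuclideanSpace ℝ (Fin n)) :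
    frob (outerSum x y) (outerSum x' y')
      = ∑ s, ∑ t, inner ℝ (x s) (x' t) * inner ℝ (y s) (y' t) := by
  simp only [frob, outerSum, Matrix.of_apply, PiLp.inner_apply, RCLike.inner_apply, conj_trivial,
    Finset.sum_mul_sum]
  have e1 : ∀ g : ι → κ → Fin n → Fin n → ℝ,
      ∑ s, ∑ t, ∑ i, ∑ j, g s t i j = ∑ i, ∑ j, ∑ s, ∑ t, g s t i j := by
    intro g
    rw [Finset.sum_congr rfl fun s _ => Finset.sum_comm, Finset.sum_comm]
    refine Finset.sum_congr rfl fun i _ => ?_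
    rw [Finset.sum_congr rfl fun s _ => Finset.sum_comm, Finset.sum_comm]
  rw [e1]
  congr! 4; ring

theorem trace_outerSum {ι : Type*} [Fintype ι] (x y : ι → EuclideanSpace ℝ (Fin n)) :
    (outerSum x y).trace = ∑ s, inner ℝ (x s) (y s) := by
  simp only [Matrix.trace, Matrix.diag_apply, outerSum, Matrix.of_apply, PiLp.inner_apply,
    RCLike.inner_apply, conj_trivial]
  rw [Finset.sum_comm]
  congr! 2; ring

theorem transpose_outerSum {ι : Type*} [Fintype ι] (x y : ι → EuclideanSpace ℝ (Fin n)) :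
    (outerSum x y)ᵀ = outerSum y x := by
  ext i j
  simp [outerSum, mul_comm]

/-- The symmetric product of two vectors. -/
def symProd (a b : EuclideanSpace ℝ (Fin n)) : Matrix (Fin n) (Fin n) ℝ :=
  outerSum ![a, b] ![b, a]

theorem symProd_mem {a b : EuclideanSpace ℝ (Fin n)} (h : inner ℝ a b = 0) :
    symProd a b ∈ Sym0 n := by
  refine ⟨?_, ?_⟩
  · rw [symProd, transpose_outerSum]
    ext i j
    simp [outerSum, add_comm]
  · simp [symProd, trace_outerSum, h, real_inner_comm]

theorem frob_symProd (a b c d : EuclideanSpace ℝ (Fin n)) :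
    frob (symProd a b) (symProd c d)
      = 2 * (inner ℝ a c * inner ℝ b d + inner ℝ a d * inner ℝ b c) := by
  simp [symProd, frob_outerSum]; ring

/-- The diagonal terms have a repeated vector in a skew pair; the two others are equal. Thus
sectional curvatures are values of the operator's form. -/
theorem IsAlgCurv.rForm_symProd (h : IsAlgCurv r) (a b : EuclideanSpace ℝ (Fin n)) :
    rForm r (symProd a b) = 2 * quad r a b a b := by
  simp only [symProd, rForm_outerSum, Fin.sum_univ_two, Matrix.cons_val_zero, Matrix.cons_val_one,
    h.quad_self_left]
  rw [h.quad_anti_left b a, h.quad_anti_right a b b a]; ring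

theorem quad_zero_fst (b c d : EuclideanSpace ℝ (Fin n)) : quad r 0 b c d = 0 := by simp [quad]
theorem quad_zero_snd (a c d : EuclideanSpace ℝ (Fin n)) : quad r a 0 c d = 0 := by simp [quad]

/-- A positive semidefinite biadditive form vanishing on the diagonal at `b` has `b` in its
radical. -/
theorem bilin_eq_zero_of_nonneg {E : Type*} [AddCommGroup E] [Module ℝ E] (V : Submodule ℝ E)
    (q : E → E → ℝ) (hsymm : ∀ x y, q x y = q y x) (hadd : ∀ x y z, q (x + y) z = q x z + q y z)
    (hsmul : ∀ (s : ℝ) x z, q (s • x) z = s * q x z) (hpos : ∀ x ∈ V, 0 ≤ q x x)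
    {b y : E} (hb : b ∈ V) (hy : y ∈ V) (hbb : q b b = 0) : q b y = 0 := by
  have hexp : ∀ s : ℝ, q (s • b + y) (s • b + y) = 2 * s * q b y + q y y := by
    intro s
    rw [hadd, hsmul, hsymm b, hadd, hsmul, hsymm y (s • b + y), hadd, hsmul, hbb, hsymm y b]
    ring
  by_contra hne
  -- The form along `s • b + y` is affine in `s`; this `s` makes its value `-1`.
  have h1 := hpos _ (V.add_mem (V.smul_mem (-(q y y + 1) / (2 * q b y)) hb) hy)
  rw [hexp] at h1
  have h2 : 2 * (-(q y y + 1) / (2 * q b y)) * q b y = -(q y y + 1) := by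
    field_simp
  linarith

/-- Nonnegative terms with nonpositive sum all vanish. Semidefiniteness in one pair of slots, then
in the other, promotes this from basis vectors to all sectional curvatures. A curvature tensor
without sectional curvature is totally skew, and Bianchi then kills it. -/
theorem IsAlgCurv.quad_eq_zero_of_sec_sum_nonpos (h : IsAlgCurv r)
    (V : Submodule ℝ (EuclideanSpace ℝ (Fin n))) {ι : Type*} [Fintype ι]
    (v : Module.Basis ι ℝ V) (hsec : ∀ a ∈ V, ∀ b ∈ V, 0 ≤ quad r a b a b)
    (hsum : ∑ s, ∑ t, quad r (v s) (v t) (v s) (v t) ≤ 0)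
    {a b c d : EuclideanSpace ℝ (Fin n)} (ha : a ∈ V) (hb : b ∈ V) (hc : c ∈ V) (hd : d ∈ V) :
    quad r a b c d = 0 := by
  have h0 : ∀ s t, quad r (v s) (v t) (v s) (v t) = 0 := by
    have hs : ∀ s, 0 ≤ ∑ t, quad r (v s) (v t) (v s) (v t) := fun s =>
      Finset.sum_nonneg fun t _ => hsec _ (v s).2 _ (v t).2
    intro s t
    have e1 := (Finset.sum_eq_zero_iff_of_nonneg fun s _ => hs s).1
      (le_antisymm hsum (Finset.sum_nonneg fun s _ => hs s)) s (Finset.mem_univ s)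
    exact (Finset.sum_eq_zero_iff_of_nonneg fun t _ => hsec _ (v s).2 _ (v t).2).1 e1 t
      (Finset.mem_univ t)
  have hspan : ∀ x ∈ V, x ∈ Submodule.span ℝ (Set.range fun s => (v s : EuclideanSpace ℝ (Fin n))) := by
    intro x hx
    have e1 := v.sum_repr ⟨x, hx⟩
    have e2 : x = ∑ s, v.repr ⟨x, hx⟩ s • (v s : EuclideanSpace ℝ (Fin n)) := by
      have e3 := (congrArg V.subtype e1).symm
      rwa [map_sum] at e3
    rw [e2]
    exact Submodule.sum_mem _ fun s _ => Submodule.smul_mem _ _ (Submodule.subset_span ⟨s, rfl⟩)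
  -- For fixed `v s` this is a semidefinite form in `y, z` on `V` that is zero on the diagonal at
  -- each basis vector, so each basis vector lies in its radical.
  have h1 : ∀ s, ∀ y ∈ V, ∀ z ∈ V, quad r (v s) y (v s) z = 0 := by
    intro s y hy z hz
    refine Submodule.span_induction (p := fun y _ => quad r (v s) y (v s) z = 0) ?_ ?_ ?_ ?_
      (hspan y hy)
    · rintro _ ⟨t, rfl⟩
      exact bilin_eq_zero_of_nonneg V (fun y z => quad r (v s) y (v s) z)
        (fun x y => h.quad_pair _ _ _ _) (fun x y z => quad_add_snd ..)
        (fun t x z => quad_smul_snd ..) (fun x hx => hsec _ (v s).2 _ hx) (v t).2 hz (h0 s t)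
    · exact quad_zero_snd _ _ _
    · intro x y _ _ hx hy; rw [quad_add_snd, hx, hy, add_zero]
    · intro t x _ hx; rw [quad_smul_snd, hx, mul_zero]
  have h2 : ∀ b ∈ V, ∀ y ∈ V, ∀ z ∈ V, quad r y b z b = 0 := by
    intro b hb y hy z hz
    refine Submodule.span_induction (p := fun y _ => quad r y b z b = 0) ?_ ?_ ?_ ?_
      (hspan y hy)
    · rintro _ ⟨t, rfl⟩
      exact bilin_eq_zero_of_nonneg V (fun y z => quad r y b z b)
        (fun x y => h.quad_pair _ _ _ _) (fun x y z => quad_add_fst ..)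
        (fun t x z => quad_smul_fst ..) (fun x hx => hsec _ hx _ hb) (v t).2 hz (h1 t b hb b hb)
    · exact quad_zero_fst _ _ _
    · intro x y _ _ hx hy; rw [quad_add_fst, hx, hy, add_zero]
    · intro t x _ hx; rw [quad_smul_fst, hx, mul_zero]
  -- Polarisation in the second and fourth slots; with the two given skew symmetries this makes the
  -- restriction to `V` alternating in all four arguments.
  have h3 : ∀ a ∈ V, ∀ b ∈ V, ∀ c ∈ V, ∀ d ∈ V, quad r a b c d = -quad r a d c b := by
    intro a ha b hb c hc d hd
    have e := h2 (b + d) (V.add_mem hb hd) a ha c hc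
    rw [quad_add_snd, quad_add_fth, quad_add_fth, h2 b hb a ha c hc, h2 d hd a ha c hc] at e
    linarith
  have b1 := h.quad_bianchi a b c d
  have e1 := h3 a ha b hb c hc d hd
  have e2 := h3 b hb c hc a ha d hd
  have e3 := h.quad_anti_left c a b d
  have e4 := h3 a ha c hc b hb d hd
  have e5 := h.quad_anti_right a d c b
  have e6 := h.quad_pair b d a c
  have e7 := h.quad_anti_left b c a d
  have e8 := h.quad_pair a c b d
  have e9 := h.quad_pair b c a d
  have e10 := h.quad_anti_right a d b c
  have e11 := h.quad_anti_right b d a c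
  have e12 := h.quad_anti_right a c b d
  have e13 := h.quad_anti_right a b c d
  have e14 := h3 a ha b hb d hd c hc
  have e15 := h3 a ha c hc d hd b hb
  linarith

/-- A reducible algebraic curvature tensor with `n`-nonnegative curvature operator of the second
kind vanishes. -/
theorem IsAlgCurv.eq_zero_of_reducible (h : IsAlgCurv r) {T : Sym0 n →ₗ[ℝ] Sym0 n}
    (hT : IsKNonneg n T) (hTr : ∀ A : Sym0 n, frob (T A).1 A.1 = rForm r A.1)
    (V : Submodule ℝ (EuclideanSpace ℝ (Fin n))) (hV0 : V ≠ ⊥) (hV1 : V ≠ ⊤)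
    (hV : ∀ a ∈ V, ∀ b ∈ Vᗮ, ∀ x y, quad r x y b a = 0) (i j k l : Fin n) : r i j k l = 0 := by
  have hmix : ∀ a ∈ V, ∀ b ∈ Vᗮ, ∀ x y, quad r a b x y = 0 := by
    intro a ha b hb x y
    rw [h.quad_anti_left, h.quad_pair, hV a ha b hb, neg_zero]
  have hmix' : ∀ a ∈ V, ∀ b ∈ Vᗮ, ∀ x y, quad r b a x y = 0 := by
    intro a ha b hb x y
    rw [h.quad_anti_left, hmix a ha b hb, neg_zero]
  -- The other two terms of the Bianchi identity have a mixed first pair.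
  have hsplit : ∀ a ∈ V, ∀ a' ∈ V, ∀ b ∈ Vᗮ, ∀ b' ∈ Vᗮ, quad r a a' b b' = 0 := by
    intro a ha a' ha' b hb b' hb'
    have e := h.quad_bianchi a a' b b'
    rwa [hmix a' ha' b hb, hmix' a ha b hb, add_zero, add_zero] at e
  have hsplit' : ∀ a ∈ V, ∀ a' ∈ V, ∀ b ∈ Vᗮ, ∀ b' ∈ Vᗮ, quad r b b' a a' = 0 := by
    intro a ha a' ha' b hb b' hb'
    rw [h.quad_pair, hsplit a ha a' ha' b hb b' hb']
  set v := stdOrthonormalBasis ℝ V with hv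
  set w := stdOrthonormalBasis ℝ Vᗮ with hw
  set p := Module.finrank ℝ V with hp
  set q := Module.finrank ℝ Vᗮ with hq
  have hpq : p + q = n := by simpa using V.finrank_add_finrank_orthogonal
  have hp0 : 1 ≤ p := Nat.one_le_iff_ne_zero.2 fun h0 => hV0 (Submodule.finrank_eq_zero.1 h0)
  have hq0 : 1 ≤ q := Nat.one_le_iff_ne_zero.2 fun h0 =>
    hV1 (Submodule.orthogonal_eq_bot_iff.1 (Submodule.finrank_eq_zero.1 h0))
  have hvw : ∀ a ∈ V, ∀ b ∈ Vᗮ, inner ℝ a b = 0 := fun a ha b hb =>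
    (Submodule.mem_orthogonal V b).1 hb a ha
  have hwv : ∀ a ∈ V, ∀ b ∈ Vᗮ, inner ℝ b a = 0 := fun a ha b hb => by
    rw [real_inner_comm]; exact hvw a ha b hb
  have hvv : ∀ s t, inner ℝ (v s : EuclideanSpace ℝ (Fin n)) (v t) = if s = t then 1 else 0 :=
    fun s t => orthonormal_iff_ite.1 v.orthonormal s t
  have hww : ∀ s t, inner ℝ (w s : EuclideanSpace ℝ (Fin n)) (w t) = if s = t then 1 else 0 :=
    fun s t => orthonormal_iff_ite.1 w.orthonormal s t
  -- The `pq` mixed tensors `v ⊙ w`, on which the quadratic form of the operator vanishes.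
  set m : Fin p × Fin q → Sym0 n := fun s =>
    ⟨symProd (v s.1 : EuclideanSpace ℝ (Fin n)) (w s.2),
      symProd_mem (hvw _ (v s.1).2 _ (w s.2).2)⟩ with hm
  have hmm : ∀ s t, frob (m s).1 (m t).1 = if s = t then 2 else 0 := by
    intro s t
    simp only [hm, frob_symProd, hvv, hww, hvw _ (v s.1).2 _ (w t.2).2, Prod.ext_iff]
    split_ifs <;> simp_all
  have key : ∀ A : Sym0 n, (∀ s, frob A.1 (m s).1 = 0) → 0 ≤ rForm r A.1 := by
    intro A hA
    rw [← hTr]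
    refine hT.frob_nonneg_of_orthogonal (by omega) m (fun s h0 => ?_) (fun s t hst => ?_)
      (fun s => ?_) ?_ A hA
    · have := hmm s s
      rw [h0] at this
      simp [frob] at this
    · rw [hmm, if_neg hst]
    · rw [hTr]
      simp only [hm]
      rw [h.rForm_symProd, hmix _ (v s.1).2 _ (w s.2).2, mul_zero]
    -- The count `p + q ≤ pq + 1` is `(p - 1)(q - 1) ≥ 0`; this is where the threshold `n` is used.
    · simp only [Fintype.card_prod, Fintype.card_fin]
      nlinarith
  have hsec0 : ∀ a b : EuclideanSpace ℝ (Fin n), (a ∈ V ∧ b ∈ V ∨ a ∈ Vᗮ ∧ b ∈ Vᗮ) →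
      inner ℝ a b = 0 → 0 ≤ quad r a b a b := by
    intro a b hab hin
    have e := key ⟨symProd a b, symProd_mem hin⟩ fun s => by
      rw [frob_symProd]
      rcases hab with ⟨ha, hb⟩ | ⟨ha, hb⟩
      · simp [hvw _ ha _ (w s.2).2, hvw _ hb _ (w s.2).2]
      · simp [hwv _ (v s.1).2 _ ha, hwv _ (v s.1).2 _ hb]
    rw [h.rForm_symProd] at e
    linarith
  have hsec1 : ∀ U : Submodule ℝ (EuclideanSpace ℝ (Fin n)), (U = V ∨ U = Vᗮ) →
      ∀ a ∈ U, ∀ b ∈ U, 0 ≤ quad r a b a b := by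
    intro U hU a ha b hb
    rcases eq_or_ne a 0 with rfl | ha0
    · rw [quad_zero_fst]
    -- Tensors `a ⊙ b` are trace-free only for orthogonal vectors; the Gram–Schmidt correction
    -- leaves `quad r a b a b` unchanged.
    set b' := b + (-(inner ℝ a b / inner ℝ a a)) • a with hb'
    have haa : inner ℝ a a ≠ (0 : ℝ) := inner_self_ne_zero.2 ha0
    have hin : inner ℝ a b' = 0 := by
      rw [hb', inner_add_right, inner_smul_right]; field_simp; ring
    have hb'U : b' ∈ U := U.add_mem hb (U.smul_mem _ ha)
    have e : quad r a b' a b' = quad r a b a b := by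
      rw [hb', quad_add_snd, quad_add_fth, quad_add_fth, quad_smul_snd, quad_smul_snd,
        quad_smul_fth, h.quad_self_left, h.quad_self_left, h.quad_pair a b a a,
        h.quad_self_left]
      ring
    rw [← e]
    refine hsec0 a b' ?_ hin
    rcases hU with rfl | rfl
    · exact Or.inl ⟨ha, hb'U⟩
    · exact Or.inr ⟨ha, hb'U⟩
  -- `outerSum x y` is `q id_V - p id_W` with `W = Vᗮ`: the factors make its trace `qp - pq = 0`,
  -- and it is orthogonal to every mixed tensor.
  set x : Fin p ⊕ Fin q → EuclideanSpace ℝ (Fin n) :=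
    Sum.elim (fun s => (q : ℝ) • (v s : EuclideanSpace ℝ (Fin n)))
      (fun s => (-p : ℝ) • (w s : EuclideanSpace ℝ (Fin n))) with hx
  set y : Fin p ⊕ Fin q → EuclideanSpace ℝ (Fin n) :=
    Sum.elim (fun s => (v s : EuclideanSpace ℝ (Fin n)))
      (fun s => (w s : EuclideanSpace ℝ (Fin n))) with hy
  have hD : outerSum x y ∈ Sym0 n := by
    refine ⟨?_, ?_⟩
    · rw [transpose_outerSum]
      ext i j
      simp only [outerSum, Matrix.of_apply]
      refine Finset.sum_congr rfl fun s _ => ?_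
      rcases s with s | s <;> simp [hx, hy] <;> ring
    · rw [trace_outerSum]
      simp only [hx, hy, Fintype.sum_sum_type, Sum.elim_inl, Sum.elim_inr, real_inner_smul_left,
        hvv, hww]
      simp
      ring
  have hDpos := key ⟨_, hD⟩ fun s => by
    simp only [hm, symProd, frob_outerSum, Fin.sum_univ_two, Fintype.sum_sum_type]
    simp [hx, hy, inner_smul_left, hvw _ (v _).2 _ (w s.2).2, hwv _ (v s.1).2 _ (w _).2]
  rw [rForm_outerSum] at hDpos
  have hVs := hsec1 V (Or.inl rfl)
  have hWs := hsec1 Vᗮ (Or.inr rfl)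
  have hVsum : 0 ≤ ∑ s, ∑ t, quad r (v s : EuclideanSpace ℝ (Fin n)) (v t) (v s) (v t) :=
    Finset.sum_nonneg fun s _ => Finset.sum_nonneg fun t _ => hVs _ (v s).2 _ (v t).2
  have hWsum : 0 ≤ ∑ s, ∑ t, quad r (w s : EuclideanSpace ℝ (Fin n)) (w t) (w s) (w t) :=
    Finset.sum_nonneg fun s _ => Finset.sum_nonneg fun t _ => hWs _ (w s).2 _ (w t).2
  -- The last two arguments occur in reversed order, whence the minus sign that plays against the
  -- nonnegative sectional curvatures.
  have hDeq : ∑ s, ∑ t, quad r (x s) (x t) (y t) (y s)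
      = -((q : ℝ) ^ 2 * ∑ s, ∑ t, quad r (v s : EuclideanSpace ℝ (Fin n)) (v t) (v s) (v t)
        + (p : ℝ) ^ 2 * ∑ s, ∑ t, quad r (w s : EuclideanSpace ℝ (Fin n)) (w t) (w s) (w t)) := by
    simp only [Fintype.sum_sum_type, hx, hy, Sum.elim_inl, Sum.elim_inr, quad_smul_fst,
      quad_smul_snd, hmix _ (v _).2 _ (w _).2, hmix' _ (v _).2 _ (w _).2, mul_zero,
      Finset.sum_const_zero, add_zero, zero_add, Finset.mul_sum, ← Finset.sum_neg_distrib, neg_add]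
    congr 1
    · congr! 2 with s _ t _
      rw [h.quad_anti_right]; ring
    · congr! 2 with s _ t _
      rw [h.quad_anti_right]; ring
  rw [hDeq] at hDpos
  have hq' : (0 : ℝ) < (q : ℝ) ^ 2 := by positivity
  have hp' : (0 : ℝ) < (p : ℝ) ^ 2 := by positivity
  have hV2 : ∑ s, ∑ t, quad r (v s : EuclideanSpace ℝ (Fin n)) (v t) (v s) (v t) ≤ 0 := by
    by_contra hneg
    push Not at hneg
    have := mul_pos hq' hneg
    have := mul_nonneg hp'.le hWsum
    linarith
  have hW2 : ∑ s, ∑ t, quad r (w s : EuclideanSpace ℝ (Fin n)) (w t) (w s) (w t) ≤ 0 := by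
    by_contra hneg
    push Not at hneg
    have := mul_pos hp' hneg
    have := mul_nonneg hq'.le hVsum
    linarith
  have hVz := fun a ha b hb c hc d hd =>
    h.quad_eq_zero_of_sec_sum_nonpos V v.toBasis hVs (by simpa using hV2) (a := a) (b := b)
      (c := c) (d := d) ha hb hc hd
  have hWz := fun a ha b hb c hc d hd =>
    h.quad_eq_zero_of_sec_sum_nonpos Vᗮ w.toBasis hWs (by simpa using hW2) (a := a) (b := b)
      (c := c) (d := d) ha hb hc hd
  -- Split every argument along `V` and its complement: pure terms vanish by the scalar curvature
  -- argument, terms with a mixed pair by `hmix` and `hmix'`, and the rest by `hsplit` and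
  -- `hsplit'`.
  have hall : ∀ a b c d, quad r a b c d = 0 := by
    have dec : ∀ a : EuclideanSpace ℝ (Fin n), ∃ a₁ ∈ V, ∃ a₂ ∈ Vᗮ, a = a₁ + a₂ := fun a =>
      V.exists_add_mem_mem_orthogonal a
    have hV3 : ∀ a b x y, a ∈ V → b ∈ Vᗮ → quad r x y a b = 0 := by
      intro a b x y ha hb
      rw [h.quad_pair, hmix a ha b hb]
    have hV4 : ∀ a b x y, a ∈ V → b ∈ Vᗮ → quad r x y b a = 0 := by
      intro a b x y ha hb
      rw [h.quad_pair, hmix' a ha b hb]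
    intro a b c d
    obtain ⟨a₁, ha₁, a₂, ha₂, rfl⟩ := dec a
    obtain ⟨b₁, hb₁, b₂, hb₂, rfl⟩ := dec b
    obtain ⟨c₁, hc₁, c₂, hc₂, rfl⟩ := dec c
    obtain ⟨d₁, hd₁, d₂, hd₂, rfl⟩ := dec d
    simp only [quad_add_fst, quad_add_snd, quad_add_trd, quad_add_fth]
    rw [hVz a₁ ha₁ b₁ hb₁ c₁ hc₁ d₁ hd₁, hWz a₂ ha₂ b₂ hb₂ c₂ hc₂ d₂ hd₂,
      hsplit a₁ ha₁ b₁ hb₁ c₂ hc₂ d₂ hd₂, hsplit' c₁ hc₁ d₁ hd₁ a₂ ha₂ b₂ hb₂]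
    simp only [hV3 _ _ _ _ hc₁ hd₂, hV4 _ _ _ _ hd₁ hc₂, hmix _ ha₁ _ hb₂, hmix' _ hb₁ _ ha₂,
      add_zero]
  rw [← quad_single (r := r)]
  exact hall _ _ _ _

end Reducible

/-! ### Coordinates of tangent vectors -/

section Coordinates

variable {n : ℕ} {M : Type*} [TopologicalSpace M]
  [ChartedSpace (EuclideanSpace ℝ (Fin n)) M] [IsManifold (𝓡 n) ∞ M]

instance : IsManifold (𝓡 n) 1 M := IsManifold.of_le (n := ∞) (by simp)

/-- The linear map sending a coordinate vector in the chart at `c` to a tangent vector. -/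
def ofCoord (c : M) (y : EuclideanSpace ℝ (Fin n)) :
    EuclideanSpace ℝ (Fin n) →L[ℝ] TangentSpace (𝓡 n) ((extChartAt (𝓡 n) c).symm y) :=
  mfderiv 𝓘(ℝ, EuclideanSpace ℝ (Fin n)) (𝓡 n) (extChartAt (𝓡 n) c).symm y

/-- The coordinates of tangent vectors at `p` in the chart at `c`, as a linear map. -/
def toCoord (c p : M) : TangentSpace (𝓡 n) p →L[ℝ] EuclideanSpace ℝ (Fin n) :=
  mfderiv (𝓡 n) 𝓘(ℝ, EuclideanSpace ℝ (Fin n)) (extChartAt (𝓡 n) c) p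

theorem vecCoord_ofCoord {c : M} {y : EuclideanSpace ℝ (Fin n)}
    (hy : y ∈ (extChartAt (𝓡 n) c).target) (a : EuclideanSpace ℝ (Fin n)) :
    vecCoord c ⟨(extChartAt (𝓡 n) c).symm y, ofCoord c y a⟩ = a := by
  have h := mfderiv_extChartAt_comp_mfderivWithin_extChartAt_symm (I := 𝓡 n) hy
  simp only [ModelWithCorners.range_eq_univ, mfderivWithin_univ] at h
  exact congrArg (fun L => L a) h

theorem ofCoord_vecCoord {c : M} {y : EuclideanSpace ℝ (Fin n)}
    (hy : y ∈ (extChartAt (𝓡 n) c).target)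
    (v : TangentSpace (𝓡 n) ((extChartAt (𝓡 n) c).symm y)) :
    ofCoord c y (vecCoord c ⟨(extChartAt (𝓡 n) c).symm y, v⟩) = v := by
  have h := mfderivWithin_extChartAt_symm_comp_mfderiv_extChartAt (I := 𝓡 n) hy
  simp only [ModelWithCorners.range_eq_univ, mfderivWithin_univ] at h
  exact congrArg (fun L => L v) h

/-- In the bundle trivialization at `c` this field is the constant section `a`. -/
theorem contMDiffOn_ofCoord (c : M) (a : EuclideanSpace ℝ (Fin n)) :
    ContMDiffOn 𝓘(ℝ, EuclideanSpace ℝ (Fin n)) (𝓡 n).tangent ∞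
      (fun y => (⟨(extChartAt (𝓡 n) c).symm y, ofCoord c y a⟩ : TangentBundle (𝓡 n) M))
      (extChartAt (𝓡 n) c).target := by
  set e := trivializationAt (EuclideanSpace ℝ (Fin n)) (TangentSpace (𝓡 n) : M → Type _) c with he
  have h1 := contMDiffOn_extChartAt_symm (I := 𝓡 n) (n := ∞) c
  have h2 := e.contMDiffOn_symm (IB := 𝓡 n) (n := ∞)
  have h3 : ContMDiffOn 𝓘(ℝ, EuclideanSpace ℝ (Fin n))
      ((𝓡 n).prod 𝓘(ℝ, EuclideanSpace ℝ (Fin n))) ∞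
      (fun y => ((extChartAt (𝓡 n) c).symm y, a)) (extChartAt (𝓡 n) c).target :=
    h1.prodMk contMDiffOn_const
  have hmem : ∀ y ∈ (extChartAt (𝓡 n) c).target,
      (extChartAt (𝓡 n) c).symm y ∈ (chartAt (EuclideanSpace ℝ (Fin n)) c).source := by
    intro y hy
    have := (extChartAt (𝓡 n) c).map_target hy
    rwa [extChartAt_source] at this
  refine (h2.comp h3 ?_).congr ?_
  · intro y hy
    rw [Set.mem_preimage, e.mem_target]
    exact hmem y hy
  · intro y hy
    have h4 := TangentBundle.symmL_trivializationAt (𝕜 := ℝ) (I := 𝓡 n) (hmem y hy)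
    simp only [ModelWithCorners.range_eq_univ, mfderivWithin_univ] at h4
    rw [(extChartAt (𝓡 n) c).right_inv hy] at h4
    have h5 : ofCoord c y a = e.symm ((extChartAt (𝓡 n) c).symm y) a := by
      rw [← e.symmL_apply (R := ℝ) (b := (extChartAt (𝓡 n) c).symm y) (hmem y hy)]
      exact (congrArg (fun L => L a) h4).symm
    rw [h5]
    exact (e.mk_symm (hmem y hy) a)

theorem contDiffOn_inner_ofCoord (g : RiemMetric n M) (c : M) (a b : EuclideanSpace ℝ (Fin n)) :
    ContDiffOn ℝ ∞ (fun y => g.inner ((extChartAt (𝓡 n) c).symm y) (ofCoord c y a) (ofCoord c y b))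
      (extChartAt (𝓡 n) c).target := by
  rw [← contMDiffOn_iff_contDiffOn]
  have h1 := contMDiffOn_extChartAt_symm (I := 𝓡 n) (n := ∞) c
  have h2 := g.contMDiff.contMDiffOn (s := Set.univ) |>.comp h1 (fun _ _ => Set.mem_univ _)
  have h3 := ContMDiffOn.clm_bundle_apply₂ (F₁ := EuclideanSpace ℝ (Fin n))
    (F₂ := EuclideanSpace ℝ (Fin n)) (F₃ := ℝ) (E₁ := fun x : M => TangentSpace (𝓡 n) x)
    (E₂ := fun x : M => TangentSpace (𝓡 n) x) (E₃ := Bundle.Trivial M ℝ) h2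
    (contMDiffOn_ofCoord c a) (contMDiffOn_ofCoord c b)
  intro y hy
  have h4 := h3 y hy
  rw [Bundle.contMDiffWithinAt_totalSpace] at h4
  exact h4.2

theorem gram_eq (g : RiemMetric n M) (c : M) (y : EuclideanSpace ℝ (Fin n)) (i j : Fin n) :
    gram g c y i j = g.inner ((extChartAt (𝓡 n) c).symm y)
      (ofCoord c y (EuclideanSpace.single i 1)) (ofCoord c y (EuclideanSpace.single j 1)) := rfl

theorem contDiffOn_gram (g : RiemMetric n M) (c : M) (i j : Fin n) :
    ContDiffOn ℝ ∞ (fun y => gram g c y i j) (extChartAt (𝓡 n) c).target :=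
  contDiffOn_inner_ofCoord g c _ _

theorem gram_symm (g : RiemMetric n M) (c : M) (y : EuclideanSpace ℝ (Fin n)) (i j : Fin n) :
    gram g c y i j = gram g c y j i := g.symm _ _ _

theorem ofCoord_eq_sum (c : M) (y a : EuclideanSpace ℝ (Fin n)) :
    ofCoord c y a = ∑ i, a i • ofCoord c y (EuclideanSpace.single i 1) := by
  have h : a = ∑ i, a i • EuclideanSpace.single i (1 : ℝ) := by
    ext j; simp [Finset.sum_apply, Pi.single_apply]
  conv_lhs => rw [h]
  rw [map_sum]
  simp only [map_smul]

theorem inner_ofCoord (g : RiemMetric n M) (c : M) (y a b : EuclideanSpace ℝ (Fin n)) :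
    g.inner ((extChartAt (𝓡 n) c).symm y) (ofCoord c y a) (ofCoord c y b)
      = ∑ i, ∑ j, gram g c y i j * a i * b j := by
  rw [ofCoord_eq_sum c y a, ofCoord_eq_sum c y b]
  simp only [map_sum, map_smul, _root_.sum_apply, _root_.smul_apply,
    smul_eq_mul, Finset.mul_sum, gram_eq]
  rw [Finset.sum_comm]
  congr! 2; ring

theorem ofCoord_ne_zero {c : M} {y : EuclideanSpace ℝ (Fin n)}
    (hy : y ∈ (extChartAt (𝓡 n) c).target) {a : EuclideanSpace ℝ (Fin n)} (ha : a ≠ 0) :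
    ofCoord c y a ≠ 0 := by
  intro h
  have h1 := vecCoord_ofCoord hy a
  rw [h] at h1
  apply ha
  rw [← h1]
  exact map_zero (toCoord c _)

theorem gram_pos (g : RiemMetric n M) {c : M} {y : EuclideanSpace ℝ (Fin n)}
    (hy : y ∈ (extChartAt (𝓡 n) c).target) {a : EuclideanSpace ℝ (Fin n)} (ha : a ≠ 0) :
    0 < ∑ i, ∑ j, gram g c y i j * a i * a j := by
  rw [← inner_ofCoord]
  exact g.pos _ _ (ofCoord_ne_zero hy ha)

theorem isUnit_det_gram (g : RiemMetric n M) {c : M} {y : EuclideanSpace ℝ (Fin n)}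
    (hy : y ∈ (extChartAt (𝓡 n) c).target) : IsUnit (gram g c y).det := by
  have h : (gram g c y).PosDef := by
    refine Matrix.PosDef.of_dotProduct_mulVec_pos ?_ ?_
    · ext i j; simp [gram_symm g c y i j]
    · intro x hx
      have hx' : (WithLp.toLp 2 x : EuclideanSpace ℝ (Fin n)) ≠ 0 := by
        intro h0; apply hx; simpa using congrArg WithLp.ofLp h0
      have := gram_pos g hy hx'
      simp only [dotProduct, Matrix.mulVec, Finset.mul_sum, star_trivial]
      refine this.trans_eq ?_
      congr! 2; ring
  exact h.det_pos.ne'.isUnit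

end Coordinates

/-! ### The Levi-Civita connection in coordinates -/

section Connection

variable {n : ℕ} {M : Type*} [TopologicalSpace M]
  [ChartedSpace (EuclideanSpace ℝ (Fin n)) M] [IsManifold (𝓡 n) ∞ M]

theorem contDiffOn_smul_vec {E F : Type*} [NormedAddCommGroup E] [NormedSpace ℝ E]
    [NormedAddCommGroup F] [NormedSpace ℝ F] {f : E → ℝ} {s : Set E} (hf : ContDiffOn ℝ ∞ f s)
    (v : F) : ContDiffOn ℝ ∞ (fun y => f y • v) s :=
  hf.smul contDiffOn_const

theorem contDiffOn_pd {f : EuclideanSpace ℝ (Fin n) → ℝ} {s : Set (EuclideanSpace ℝ (Fin n))}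
    (hf : ContDiffOn ℝ ∞ f s) (hs : IsOpen s) (i : Fin n) : ContDiffOn ℝ ∞ (pd i f) s :=
  (hf.fderiv_of_isOpen hs (by simp)).clm_apply contDiffOn_const

theorem contDiffOn_det {E : Type*} [NormedAddCommGroup E] [NormedSpace ℝ E] {m : ℕ}
    {A : E → Matrix (Fin m) (Fin m) ℝ} {s : Set E}
    (hA : ∀ i j, ContDiffOn ℝ ∞ (fun y => A y i j) s) : ContDiffOn ℝ ∞ (fun y => (A y).det) s := by
  simp only [Matrix.det_apply]
  refine ContDiffOn.sum fun σ _ => ContDiffOn.const_smul _ ?_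
  exact contDiffOn_prod fun i _ => hA _ _

/-- Cramer's rule: the entries are quotients of determinants in the metric coefficients, with
nonzero denominator by positive definiteness. -/
theorem contDiffOn_inv_gram (g : RiemMetric n M) (c : M) (i j : Fin n) :
    ContDiffOn ℝ ∞ (fun y => (gram g c y)⁻¹ i j) (extChartAt (𝓡 n) c).target := by
  simp only [Matrix.inv_def, Ring.inverse_eq_inv', Matrix.smul_apply, smul_eq_mul,
    Matrix.adjugate_apply]
  refine ContDiffOn.mul (ContDiffOn.inv (contDiffOn_det (contDiffOn_gram g c)) fun y hy =>
    (isUnit_det_gram g hy).ne_zero) (contDiffOn_det fun k l => ?_)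
  by_cases hk : k = j
  · subst hk
    simp only [Matrix.updateRow_self]
    exact contDiffOn_const
  · simp only [Matrix.updateRow_ne hk]
    exact contDiffOn_gram g c k l

theorem contDiffOn_christoffel (g : RiemMetric n M) (c : M) (k i j : Fin n) :
    ContDiffOn ℝ ∞ (christoffel g c k i j) (extChartAt (𝓡 n) c).target := by
  have ho := isOpen_extChartAt_target (I := 𝓡 n) c
  unfold christoffel
  refine contDiffOn_const.mul (ContDiffOn.sum fun l _ => (contDiffOn_inv_gram g c k l).mul ?_)
  exact ((contDiffOn_pd (contDiffOn_gram g c j l) ho i).add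
    (contDiffOn_pd (contDiffOn_gram g c i l) ho j)).sub (contDiffOn_pd (contDiffOn_gram g c i j) ho l)

theorem christoffel_symm (g : RiemMetric n M) (c : M) (k i j : Fin n) :
    christoffel g c k i j = christoffel g c k j i := by
  funext y
  unfold christoffel
  have : (fun z => gram g c z i j) = fun z => gram g c z j i := funext fun z => gram_symm g c z i j
  rw [this]
  congr! 4
  ring

/-- The bilinear form `a, b ↦ aᵢ bⱼ`. -/
def coordBilin (i j : Fin n) :
    EuclideanSpace ℝ (Fin n) →L[ℝ] EuclideanSpace ℝ (Fin n) →L[ℝ] ℝ :=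
  (EuclideanSpace.proj i : EuclideanSpace ℝ (Fin n) →L[ℝ] ℝ).smulRight
    (EuclideanSpace.proj j : EuclideanSpace ℝ (Fin n) →L[ℝ] ℝ)

theorem coordBilin_apply (i j : Fin n) (a b : EuclideanSpace ℝ (Fin n)) :
    coordBilin i j a b = a i * b j := by
  simp [coordBilin]

/-- The bilinear map `a, b ↦ aᵢ bⱼ ∂ₖ`. -/
def coordBilinVec (k i j : Fin n) :
    EuclideanSpace ℝ (Fin n) →L[ℝ] EuclideanSpace ℝ (Fin n) →L[ℝ] EuclideanSpace ℝ (Fin n) :=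
  (EuclideanSpace.proj i : EuclideanSpace ℝ (Fin n) →L[ℝ] ℝ).smulRight
    ((EuclideanSpace.proj j : EuclideanSpace ℝ (Fin n) →L[ℝ] ℝ).smulRight
      (EuclideanSpace.single k (1 : ℝ)))

theorem coordBilinVec_apply (k i j : Fin n) (a b : EuclideanSpace ℝ (Fin n)) :
    coordBilinVec k i j a b = (a i * b j) • EuclideanSpace.single k (1 : ℝ) := by
  simp [coordBilinVec, smul_smul]

/-- The metric in the chart at `c`, as a function with values in bilinear forms. -/
def gramL (g : RiemMetric n M) (c : M) (y : EuclideanSpace ℝ (Fin n)) :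
    EuclideanSpace ℝ (Fin n) →L[ℝ] EuclideanSpace ℝ (Fin n) →L[ℝ] ℝ :=
  ∑ i, ∑ j, gram g c y i j • coordBilin i j

/-- The Christoffel symbols in the chart at `c`, as a function with values in bilinear maps. -/
def chrL (g : RiemMetric n M) (c : M) (y : EuclideanSpace ℝ (Fin n)) :
    EuclideanSpace ℝ (Fin n) →L[ℝ] EuclideanSpace ℝ (Fin n) →L[ℝ] EuclideanSpace ℝ (Fin n) :=
  ∑ k, ∑ i, ∑ j, christoffel g c k i j y • coordBilinVec k i j

theorem gramL_apply (g : RiemMetric n M) (c : M) (y a b : EuclideanSpace ℝ (Fin n)) :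
    gramL g c y a b = ∑ i, ∑ j, gram g c y i j * a i * b j := by
  simp [gramL, coordBilin_apply, mul_assoc]

theorem chrL_apply (g : RiemMetric n M) (c : M) (y a b : EuclideanSpace ℝ (Fin n)) :
    chrL g c y a b = christoffelVec g c y a b := by
  ext m
  simp [chrL, coordBilinVec_apply, christoffelVec, Finset.sum_apply, mul_assoc, Pi.single_apply,
    Finset.sum_ite_eq]

theorem gramL_single (g : RiemMetric n M) (c : M) (y : EuclideanSpace ℝ (Fin n)) (i j : Fin n) :
    gramL g c y (EuclideanSpace.single i 1) (EuclideanSpace.single j 1) = gram g c y i j := by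
  simp [gramL_apply]

theorem chrL_single (g : RiemMetric n M) (c : M) (y : EuclideanSpace ℝ (Fin n)) (i j k : Fin n) :
    chrL g c y (EuclideanSpace.single i 1) (EuclideanSpace.single j 1) k
      = christoffel g c k i j y := by
  simp [chrL_apply, christoffelVec]

theorem gramL_symm (g : RiemMetric n M) (c : M) (y a b : EuclideanSpace ℝ (Fin n)) :
    gramL g c y a b = gramL g c y b a := by
  rw [gramL_apply, gramL_apply, Finset.sum_comm]
  congr! 2 with i _ j _
  rw [gram_symm]; ring

theorem gramL_pos (g : RiemMetric n M) {c : M} {y : EuclideanSpace ℝ (Fin n)}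
    (hy : y ∈ (extChartAt (𝓡 n) c).target) {a : EuclideanSpace ℝ (Fin n)} (ha : a ≠ 0) :
    0 < gramL g c y a a := by
  rw [gramL_apply]; exact gram_pos g hy ha

theorem eq_of_gramL_eq (g : RiemMetric n M) {c : M} {y : EuclideanSpace ℝ (Fin n)}
    (hy : y ∈ (extChartAt (𝓡 n) c).target) {a b : EuclideanSpace ℝ (Fin n)}
    (h : ∀ w, gramL g c y a w = gramL g c y b w) : a = b := by
  by_contra hne
  have h1 := gramL_pos g hy (sub_ne_zero.2 hne)
  rw [map_sub (gramL g c y) a b, _root_.sub_apply, h, sub_self] at h1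
  exact lt_irrefl _ h1

theorem chrL_symm (g : RiemMetric n M) (c : M) (y a b : EuclideanSpace ℝ (Fin n)) :
    chrL g c y a b = chrL g c y b a := by
  ext k
  simp only [chrL_apply, christoffelVec]
  rw [Finset.sum_comm]
  congr! 2 with i _ j _
  rw [christoffel_symm]; ring

theorem contDiffOn_gramL (g : RiemMetric n M) (c : M) :
    ContDiffOn ℝ ∞ (gramL g c) (extChartAt (𝓡 n) c).target := by
  unfold gramL
  exact ContDiffOn.sum fun i _ => ContDiffOn.sum fun j _ =>
    contDiffOn_smul_vec (contDiffOn_gram g c i j) _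

theorem contDiffOn_chrL (g : RiemMetric n M) (c : M) :
    ContDiffOn ℝ ∞ (chrL g c) (extChartAt (𝓡 n) c).target := by
  unfold chrL
  exact ContDiffOn.sum fun k _ => ContDiffOn.sum fun i _ => ContDiffOn.sum fun j _ =>
    contDiffOn_smul_vec (contDiffOn_christoffel g c k i j) _

theorem differentiableAt_gramL (g : RiemMetric n M) {c : M} {y : EuclideanSpace ℝ (Fin n)}
    (hy : y ∈ (extChartAt (𝓡 n) c).target) : DifferentiableAt ℝ (gramL g c) y :=
  ((contDiffOn_gramL g c).contDiffAt ((isOpen_extChartAt_target c).mem_nhds hy)).differentiableAt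
    (by simp)

theorem differentiableAt_chrL (g : RiemMetric n M) {c : M} {y : EuclideanSpace ℝ (Fin n)}
    (hy : y ∈ (extChartAt (𝓡 n) c).target) : DifferentiableAt ℝ (chrL g c) y :=
  ((contDiffOn_chrL g c).contDiffAt ((isOpen_extChartAt_target c).mem_nhds hy)).differentiableAt
    (by simp)

theorem fderiv_gramL_single (g : RiemMetric n M) {c : M} {y : EuclideanSpace ℝ (Fin n)}
    (hy : y ∈ (extChartAt (𝓡 n) c).target) (i j k : Fin n) :
    fderiv ℝ (gramL g c) y (EuclideanSpace.single i 1) (EuclideanSpace.single j 1)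
      (EuclideanSpace.single k 1) = pd i (fun z => gram g c z j k) y := by
  have h := (differentiableAt_gramL g hy).hasFDerivAt
  have h1 := (h.clm_apply (hasFDerivAt_const (EuclideanSpace.single j (1 : ℝ)) y)).clm_apply
    (hasFDerivAt_const (EuclideanSpace.single k (1 : ℝ)) y)
  simp only [gramL_single] at h1
  rw [pd, h1.fderiv]
  simp

theorem fderiv_chrL_single (g : RiemMetric n M) {c : M} {y : EuclideanSpace ℝ (Fin n)}
    (hy : y ∈ (extChartAt (𝓡 n) c).target) (i j k l : Fin n) :
    fderiv ℝ (chrL g c) y (EuclideanSpace.single i 1) (EuclideanSpace.single j 1)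
      (EuclideanSpace.single k 1) l = pd i (christoffel g c l j k) y := by
  have h := (differentiableAt_chrL g hy).hasFDerivAt
  have h1 := (h.clm_apply (hasFDerivAt_const (EuclideanSpace.single j (1 : ℝ)) y)).clm_apply
    (hasFDerivAt_const (EuclideanSpace.single k (1 : ℝ)) y)
  have h2 := (EuclideanSpace.proj l : EuclideanSpace ℝ (Fin n) →L[ℝ] ℝ).hasFDerivAt.comp y h1
  have h3 : ((EuclideanSpace.proj l : EuclideanSpace ℝ (Fin n) →L[ℝ] ℝ) ∘ fun z =>
      chrL g c z (EuclideanSpace.single j 1) (EuclideanSpace.single k 1)) = christoffel g c l j k := by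
    funext z
    simp [chrL_single]
  rw [h3] at h2
  rw [pd, h2.fderiv]
  simp

theorem fderiv_gramL_symm (g : RiemMetric n M) {c : M} {y : EuclideanSpace ℝ (Fin n)}
    (hy : y ∈ (extChartAt (𝓡 n) c).target) (u a b : EuclideanSpace ℝ (Fin n)) :
    fderiv ℝ (gramL g c) y u a b = fderiv ℝ (gramL g c) y u b a := by
  have h := (differentiableAt_gramL g hy).hasFDerivAt
  have h1 := (h.clm_apply (hasFDerivAt_const a y)).clm_apply (hasFDerivAt_const b y)
  have h2 := (h.clm_apply (hasFDerivAt_const b y)).clm_apply (hasFDerivAt_const a y)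
  simp only [gramL_symm g c _ b a] at h2
  have h3 := congrArg (fun L => L u) (h1.unique h2)
  simpa using h3

/-- Lowering the index cancels the inverse metric in the definition of the Christoffel symbols. -/
theorem koszul_single (g : RiemMetric n M) {c : M} {y : EuclideanSpace ℝ (Fin n)}
    (hy : y ∈ (extChartAt (𝓡 n) c).target) (i j l : Fin n) :
    2 * ∑ m, gram g c y l m * christoffel g c m i j y
      = pd i (fun z => gram g c z j l) y + pd j (fun z => gram g c z i l) y
        - pd l (fun z => gram g c z i j) y := by
  set P : Fin n → ℝ := fun l => pd i (fun z => gram g c z j l) y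
    + pd j (fun z => gram g c z i l) y - pd l (fun z => gram g c z i j) y with hP
  have h1 : (fun m => christoffel g c m i j y) = (1 / 2 : ℝ) • ((gram g c y)⁻¹ *ᵥ P) := by
    funext m
    simp [christoffel, Matrix.mulVec, dotProduct, hP]
  have h2 : ∑ m, gram g c y l m * christoffel g c m i j y
      = ((gram g c y) *ᵥ (fun m => christoffel g c m i j y)) l := rfl
  rw [h2, h1, Matrix.mulVec_smul, Matrix.mulVec_mulVec,
    Matrix.mul_nonsing_inv _ (isUnit_det_gram g hy), Matrix.one_mulVec]
  simp [hP]

theorem koszul (g : RiemMetric n M) {c : M} {y : EuclideanSpace ℝ (Fin n)}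
    (hy : y ∈ (extChartAt (𝓡 n) c).target) (u v w : EuclideanSpace ℝ (Fin n)) :
    2 * gramL g c y (chrL g c y u v) w
      = fderiv ℝ (gramL g c) y u v w + fderiv ℝ (gramL g c) y v u w
        - fderiv ℝ (gramL g c) y w u v := by
  have e : ∀ a : EuclideanSpace ℝ (Fin n), a = ∑ i, a i • EuclideanSpace.single i (1 : ℝ) := by
    intro a; ext j; simp [Finset.sum_apply, Pi.single_apply]
  have hs : ∀ i j l, 2 * gramL g c y (chrL g c y (EuclideanSpace.single i 1)
      (EuclideanSpace.single j 1)) (EuclideanSpace.single l 1)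
      = fderiv ℝ (gramL g c) y (EuclideanSpace.single i 1) (EuclideanSpace.single j 1)
          (EuclideanSpace.single l 1)
        + fderiv ℝ (gramL g c) y (EuclideanSpace.single j 1) (EuclideanSpace.single i 1)
          (EuclideanSpace.single l 1)
        - fderiv ℝ (gramL g c) y (EuclideanSpace.single l 1) (EuclideanSpace.single i 1)
          (EuclideanSpace.single j 1) := by
    intro i j l
    rw [fderiv_gramL_single g hy, fderiv_gramL_single g hy, fderiv_gramL_single g hy,
      ← koszul_single g hy, gramL_symm, gramL_apply]
    simp [chrL_single]
  -- A trilinear function that vanishes on basis triples is zero; it is applied to the difference of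
  -- the two sides.
  have h1 : ∀ (f : EuclideanSpace ℝ (Fin n) → EuclideanSpace ℝ (Fin n) →
      EuclideanSpace ℝ (Fin n) → ℝ)
      (_ : ∀ (s : Fin n → ℝ) (a : Fin n → EuclideanSpace ℝ (Fin n)) b c,
        f (∑ i, s i • a i) b c = ∑ i, s i * f (a i) b c)
      (_ : ∀ (s : Fin n → ℝ) (a : Fin n → EuclideanSpace ℝ (Fin n)) b c,
        f b (∑ i, s i • a i) c = ∑ i, s i * f b (a i) c)
      (_ : ∀ (s : Fin n → ℝ) (a : Fin n → EuclideanSpace ℝ (Fin n)) b c,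
        f b c (∑ i, s i • a i) = ∑ i, s i * f b c (a i))
      (_ : ∀ i j l, f (EuclideanSpace.single i 1) (EuclideanSpace.single j 1)
        (EuclideanSpace.single l 1) = 0), ∀ a b c, f a b c = 0 := by
    intro f h1 h2 h3 h4 a b c
    rw [e a, e b, e c]
    simp [h1, h2, h3, h4]
  have h2 := h1 (fun u v w => 2 * gramL g c y (chrL g c y u v) w
    - (fderiv ℝ (gramL g c) y u v w + fderiv ℝ (gramL g c) y v u w
        - fderiv ℝ (gramL g c) y w u v)) ?_ ?_ ?_ ?_ u v w
  · exact sub_eq_zero.1 h2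
  · intro s a b c
    simp only [map_sum, map_smul, _root_.sum_apply, _root_.smul_apply, smul_eq_mul,
      Finset.mul_sum, ← Finset.sum_add_distrib, ← Finset.sum_sub_distrib]
    congr! 1; ring
  · intro s a b c
    simp only [map_sum, map_smul, _root_.sum_apply, _root_.smul_apply, smul_eq_mul,
      Finset.mul_sum, ← Finset.sum_add_distrib, ← Finset.sum_sub_distrib]
    congr! 1; ring
  · intro s a b c
    simp only [map_sum, map_smul, _root_.sum_apply, _root_.smul_apply, smul_eq_mul,
      Finset.mul_sum, ← Finset.sum_add_distrib, ← Finset.sum_sub_distrib]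
    congr! 1; ring
  · intro i j l
    exact sub_eq_zero.2 (hs i j l)

/-- Metric compatibility: add the Koszul formulas for `(u, v, w)` and `(u, w, v)`; all derivatives
of the metric except the one along `u` cancel. -/
theorem fderiv_gramL (g : RiemMetric n M) {c : M} {y : EuclideanSpace ℝ (Fin n)}
    (hy : y ∈ (extChartAt (𝓡 n) c).target) (u v w : EuclideanSpace ℝ (Fin n)) :
    fderiv ℝ (gramL g c) y u v w
      = gramL g c y (chrL g c y u v) w + gramL g c y v (chrL g c y u w) := by
  have h1 := koszul g hy u v w
  have h2 := koszul g hy u w v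
  rw [gramL_symm g c y v]
  have h3 := fderiv_gramL_symm g hy u v w
  have h4 := fderiv_gramL_symm g hy v u w
  have h5 := fderiv_gramL_symm g hy w u v
  linarith

end Connection

/-! ### The curvature tensor -/

/-- The curvature of a connection is skew with respect to a parallel metric. -/
theorem metric_curvature_skew {E : Type*} [NormedAddCommGroup E] [NormedSpace ℝ E]
    {G : E → E →L[ℝ] E →L[ℝ] ℝ} {Γ : E → E →L[ℝ] E →L[ℝ] E} {y : E}
    (hG : ContDiffAt ℝ ∞ G y) (hΓ : DifferentiableAt ℝ Γ y)
    (hc : ∀ᶠ z in nhds y, ∀ u v w, fderiv ℝ G z u v w = G z (Γ z u v) w + G z v (Γ z u w))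
    (u v a b : E) :
    G y (fderiv ℝ Γ y u v a - fderiv ℝ Γ y v u a + (Γ y u (Γ y v a) - Γ y v (Γ y u a))) b
      = -G y a (fderiv ℝ Γ y u v b - fderiv ℝ Γ y v u b + (Γ y u (Γ y v b) - Γ y v (Γ y u b))) := by
  have hD : DifferentiableAt ℝ (fderiv ℝ G) y :=
    (hG.fderiv_right (m := ∞) (by simp)).differentiableAt (by simp)
  have hG1 := (hG.differentiableAt (by simp)).hasFDerivAt
  -- Differentiate the compatibility identity once more. Its antisymmetrization in `u, v` vanishes
  -- on the left and yields the curvature on the right.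
  have key : ∀ u v, fderiv ℝ (fderiv ℝ G) y u v a b
      = fderiv ℝ G y u (Γ y v a) b + G y (fderiv ℝ Γ y u v a) b
        + (fderiv ℝ G y u a (Γ y v b) + G y a (fderiv ℝ Γ y u v b)) := by
    intro u v
    have h1 := ((hD.hasFDerivAt.clm_apply (hasFDerivAt_const v y)).clm_apply
      (hasFDerivAt_const a y)).clm_apply (hasFDerivAt_const b y)
    have hCa := (hΓ.hasFDerivAt.clm_apply (hasFDerivAt_const v y)).clm_apply (hasFDerivAt_const a y)
    have hCb := (hΓ.hasFDerivAt.clm_apply (hasFDerivAt_const v y)).clm_apply (hasFDerivAt_const b y)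
    have h2 := ((hG1.clm_apply hCa).clm_apply (hasFDerivAt_const b y)).add
      ((hG1.clm_apply (hasFDerivAt_const a y)).clm_apply hCb)
    have hev : (fun z => fderiv ℝ G z v a b) =ᶠ[nhds y]
        ((fun z => G z (Γ z v a) b) + fun z => G z a (Γ z v b)) := by
      filter_upwards [hc] with z hz
      exact hz v a b
    have h3 := congrArg (fun L => L u) ((h2.congr_of_eventuallyEq hev).unique h1)
    simp only [_root_.add_apply, ContinuousLinearMap.comp_apply, ContinuousLinearMap.flip_apply,
      _root_.zero_apply, map_zero, zero_add] at h3
    linarith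
  have hs := hG.isSymmSndFDerivAt (by
    rw [minSmoothness_of_isRCLikeNormedField]; exact WithTop.coe_le_coe.2 le_top)
  have h0 : fderiv ℝ (fderiv ℝ G) y u v a b = fderiv ℝ (fderiv ℝ G) y v u a b := by
    rw [hs.eq]
  rw [key, key] at h0
  simp only [hc.self_of_nhds] at h0
  simp only [map_add, map_sub, _root_.add_apply, _root_.sub_apply]
  linarith

section Curvature

variable {n : ℕ} {M : Type*} [TopologicalSpace M]
  [ChartedSpace (EuclideanSpace ℝ (Fin n)) M] [IsManifold (𝓡 n) ∞ M]

/-- The curvature `R(u, v) w` in the chart at `c`. -/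
def curvVec (g : RiemMetric n M) (c : M) (y u v w : EuclideanSpace ℝ (Fin n)) :
    EuclideanSpace ℝ (Fin n) :=
  fderiv ℝ (chrL g c) y u v w - fderiv ℝ (chrL g c) y v u w
    + (chrL g c y u (chrL g c y v w) - chrL g c y v (chrL g c y u w))

theorem contDiffAt_gramL (g : RiemMetric n M) {c : M} {y : EuclideanSpace ℝ (Fin n)}
    (hy : y ∈ (extChartAt (𝓡 n) c).target) : ContDiffAt ℝ ∞ (gramL g c) y :=
  (contDiffOn_gramL g c).contDiffAt ((isOpen_extChartAt_target c).mem_nhds hy)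

theorem fderiv_chrL_symm (g : RiemMetric n M) {c : M} {y : EuclideanSpace ℝ (Fin n)}
    (hy : y ∈ (extChartAt (𝓡 n) c).target) (u a b : EuclideanSpace ℝ (Fin n)) :
    fderiv ℝ (chrL g c) y u a b = fderiv ℝ (chrL g c) y u b a := by
  have h := (differentiableAt_chrL g hy).hasFDerivAt
  have h1 := (h.clm_apply (hasFDerivAt_const a y)).clm_apply (hasFDerivAt_const b y)
  have h2 := (h.clm_apply (hasFDerivAt_const b y)).clm_apply (hasFDerivAt_const a y)
  simp only [chrL_symm g c _ b a] at h2
  have h3 := congrArg (fun L => L u) (h1.unique h2)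
  simpa using h3

theorem gramL_curvVec_skew (g : RiemMetric n M) {c : M} {y : EuclideanSpace ℝ (Fin n)}
    (hy : y ∈ (extChartAt (𝓡 n) c).target) (u v a b : EuclideanSpace ℝ (Fin n)) :
    gramL g c y (curvVec g c y u v a) b = -gramL g c y a (curvVec g c y u v b) :=
  metric_curvature_skew (contDiffAt_gramL g hy) (differentiableAt_chrL g hy)
    (Filter.eventually_of_mem ((isOpen_extChartAt_target (I := 𝓡 n) c).mem_nhds hy)
      fun _ hz => fderiv_gramL g hz) u v a b

theorem curvVec_anti (g : RiemMetric n M) (c : M) (y u v w : EuclideanSpace ℝ (Fin n)) :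
    curvVec g c y u v w = -curvVec g c y v u w := by
  simp only [curvVec]; abel

/-- Since the Christoffel symbols and their derivatives are symmetric in the lower slots, the cyclic
sum cancels in pairs. -/
theorem curvVec_bianchi (g : RiemMetric n M) {c : M} {y : EuclideanSpace ℝ (Fin n)}
    (hy : y ∈ (extChartAt (𝓡 n) c).target) (u v w : EuclideanSpace ℝ (Fin n)) :
    curvVec g c y u v w + curvVec g c y v w u + curvVec g c y w u v = 0 := by
  simp only [curvVec]
  rw [fderiv_chrL_symm g hy u w v, fderiv_chrL_symm g hy v w u, fderiv_chrL_symm g hy w v u,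
    chrL_symm g c y w u, chrL_symm g c y w v, chrL_symm g c y v u]
  abel

theorem curvVec_single (g : RiemMetric n M) {c : M} {y : EuclideanSpace ℝ (Fin n)}
    (hy : y ∈ (extChartAt (𝓡 n) c).target) (i j k l : Fin n) :
    curvVec g c y (EuclideanSpace.single i 1) (EuclideanSpace.single j 1)
      (EuclideanSpace.single k 1) l = curvUp g c l k i j y := by
  have h : ∀ (i : Fin n) (a : EuclideanSpace ℝ (Fin n)), chrL g c y (EuclideanSpace.single i 1) a l
      = ∑ m, christoffel g c l i m y * a m := by
    intro i a
    simp [chrL_apply, christoffelVec]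
  simp only [curvVec, PiLp.add_apply, PiLp.sub_apply, fderiv_chrL_single g hy, h, chrL_single,
    curvUp, Finset.sum_sub_distrib]

theorem curvLow_eq (g : RiemMetric n M) {c : M} {y : EuclideanSpace ℝ (Fin n)}
    (hy : y ∈ (extChartAt (𝓡 n) c).target) (i j k l : Fin n) :
    curvLow g c i j k l y = gramL g c y (EuclideanSpace.single k 1)
      (curvVec g c y (EuclideanSpace.single i 1) (EuclideanSpace.single j 1)
        (EuclideanSpace.single l 1)) := by
  rw [gramL_apply]
  simp [curvLow, curvVec_single g hy]

theorem isAlgCurv_curvLow (g : RiemMetric n M) {c : M} {y : EuclideanSpace ℝ (Fin n)}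
    (hy : y ∈ (extChartAt (𝓡 n) c).target) : IsAlgCurv fun i j k l => curvLow g c i j k l y where
  anti_left i j k l := by
    rw [curvLow_eq g hy, curvLow_eq g hy, curvVec_anti, map_neg]
  anti_right i j k l := by
    rw [curvLow_eq g hy, curvLow_eq g hy, gramL_symm, gramL_curvVec_skew g hy]
  bianchi i j k l := by
    -- The vector acted on by the curvature is indexed by the fourth slot; skewness moves it to the
    -- third, so that the cyclic sum runs over its three arguments.
    have h : ∀ i j k l, curvLow g c i j k l y = -gramL g c y (EuclideanSpace.single l 1)
        (curvVec g c y (EuclideanSpace.single i 1) (EuclideanSpace.single j 1)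
        (EuclideanSpace.single k 1)) := by
      intro i j k l
      rw [curvLow_eq g hy, gramL_symm, gramL_curvVec_skew g hy]
    rw [h, h, h, ← neg_add, ← neg_add, ← map_add, ← map_add, curvVec_bianchi g hy, map_zero,
      neg_zero]

theorem isLinearMap_apply_eq_sum {f : EuclideanSpace ℝ (Fin n) → ℝ} (hf : IsLinearMap ℝ f)
    (a : EuclideanSpace ℝ (Fin n)) : f a = ∑ i, a i * f (EuclideanSpace.single i (1 : ℝ)) := by
  have e : a = ∑ i, a i • EuclideanSpace.single i (1 : ℝ) := by
    ext j; simp [Finset.sum_apply, Pi.single_apply]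
  have h := congrArg (hf.mk' f) e
  simpa only [map_sum, map_smul, IsLinearMap.mk'_apply, smul_eq_mul] using h

theorem eq_quad_of_isLinearMap {f : EuclideanSpace ℝ (Fin n) → EuclideanSpace ℝ (Fin n) →
      EuclideanSpace ℝ (Fin n) → EuclideanSpace ℝ (Fin n) → ℝ}
    (h1 : ∀ b c d, IsLinearMap ℝ fun a => f a b c d) (h2 : ∀ a c d, IsLinearMap ℝ fun b => f a b c d)
    (h3 : ∀ a b d, IsLinearMap ℝ fun c => f a b c d) (h4 : ∀ a b c, IsLinearMap ℝ fun d => f a b c d)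
    (a b c d : EuclideanSpace ℝ (Fin n)) :
    f a b c d = quad (fun i j k l => f (EuclideanSpace.single i 1) (EuclideanSpace.single j 1)
      (EuclideanSpace.single k 1) (EuclideanSpace.single l 1)) a b c d := by
  rw [isLinearMap_apply_eq_sum (h1 b c d) a, quad]
  refine Finset.sum_congr rfl fun i _ => ?_
  rw [isLinearMap_apply_eq_sum (h2 _ c d) b, Finset.mul_sum]
  refine Finset.sum_congr rfl fun j _ => ?_
  rw [isLinearMap_apply_eq_sum (h3 _ _ d) c, Finset.mul_sum, Finset.mul_sum]
  refine Finset.sum_congr rfl fun k _ => ?_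
  rw [isLinearMap_apply_eq_sum (h4 _ _ _) d, Finset.mul_sum, Finset.mul_sum, Finset.mul_sum]
  refine Finset.sum_congr rfl fun l _ => ?_
  ring

theorem quad_curvLow (g : RiemMetric n M) {c : M} {y : EuclideanSpace ℝ (Fin n)}
    (hy : y ∈ (extChartAt (𝓡 n) c).target) (u v w z : EuclideanSpace ℝ (Fin n)) :
    quad (fun i j k l => curvLow g c i j k l y) u v w z = gramL g c y w (curvVec g c y u v z) := by
  simp only [curvLow_eq g hy]
  refine (eq_quad_of_isLinearMap (f := fun u v w z => gramL g c y w (curvVec g c y u v z))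
    ?_ ?_ ?_ ?_ u v w z).symm
  · intro b c d
    constructor
    · intro x x'
      simp only [curvVec, map_add, map_sub, _root_.add_apply]; ring
    · intro s x
      simp only [curvVec, map_add, map_sub, map_smul, _root_.smul_apply, smul_eq_mul]; ring
  · intro b c d
    constructor
    · intro x x'
      simp only [curvVec, map_add, map_sub, _root_.add_apply]; ring
    · intro s x
      simp only [curvVec, map_add, map_sub, map_smul, _root_.smul_apply, smul_eq_mul]; ring
  · intro b c d
    constructor
    · intro x x'
      simp only [map_add, _root_.add_apply]
    · intro s x
      simp only [map_smul, _root_.smul_apply]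
  · intro b c d
    constructor
    · intro x x'
      simp only [curvVec, map_add, map_sub]; ring
    · intro s x
      simp only [curvVec, map_add, map_sub, map_smul, smul_eq_mul]; ring

theorem riemannTensor_eq_quad (g : RiemMetric n M) (x : M) (u v w z : TangentSpace (𝓡 n) x) :
    riemannTensor g x u v w z = quad (fun i j k l => curvLow g x i j k l (extChartAt (𝓡 n) x x))
      (toCoord x x u) (toCoord x x v) (toCoord x x w) (toCoord x x z) := rfl

end Curvature

/-! ### Change of charts -/

/-- The transformation law of Christoffel symbols, for metrics related by a map `ψ`. -/
theorem christoffel_change_of_koszul {E : Type*} [NormedAddCommGroup E] [NormedSpace ℝ E]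
    {G G' : E → E →L[ℝ] E →L[ℝ] ℝ} {Γ Γ' : E →L[ℝ] E →L[ℝ] E} {ψ : E → E} {y : E}
    (hG : DifferentiableAt ℝ G y) (hG' : DifferentiableAt ℝ G' (ψ y)) (hψ : ContDiffAt ℝ ∞ ψ y)
    (hGG' : ∀ᶠ z in nhds y, ∀ a b, G z a b = G' (ψ z) (fderiv ℝ ψ z a) (fderiv ℝ ψ z b))
    (hsymm : ∀ a b, G' (ψ y) a b = G' (ψ y) b a)
    (hnd : ∀ a b, (∀ w, G' (ψ y) a w = G' (ψ y) b w) → a = b)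
    (hsurj : Function.Surjective (fderiv ℝ ψ y))
    (hk : ∀ u v w, 2 * G y (Γ u v) w
      = fderiv ℝ G y u v w + fderiv ℝ G y v u w - fderiv ℝ G y w u v)
    (hk' : ∀ u v w, 2 * G' (ψ y) (Γ' u v) w = fderiv ℝ G' (ψ y) u v w
      + fderiv ℝ G' (ψ y) v u w - fderiv ℝ G' (ψ y) w u v) (u v : E) :
    Γ' (fderiv ℝ ψ y u) (fderiv ℝ ψ y v)
      = fderiv ℝ ψ y (Γ u v) - fderiv ℝ (fderiv ℝ ψ) y u v := by
  have hD : DifferentiableAt ℝ (fderiv ℝ ψ) y :=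
    (hψ.fderiv_right (m := ∞) (by simp)).differentiableAt (by simp)
  have hψ1 := (hψ.differentiableAt (by simp)).hasFDerivAt
  have hs := hψ.isSymmSndFDerivAt (by
    rw [minSmoothness_of_isRCLikeNormedField]; exact WithTop.coe_le_coe.2 le_top)
  -- The derivative of the pullback relation. In the Koszul combination the second derivatives of
  -- `ψ` cancel except for twice the term pairing `D²ψ(u, v)` with `Dψ w`.
  have key : ∀ u a b, fderiv ℝ G y u a b
      = fderiv ℝ G' (ψ y) (fderiv ℝ ψ y u) (fderiv ℝ ψ y a) (fderiv ℝ ψ y b)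
        + G' (ψ y) (fderiv ℝ (fderiv ℝ ψ) y u a) (fderiv ℝ ψ y b)
        + G' (ψ y) (fderiv ℝ ψ y a) (fderiv ℝ (fderiv ℝ ψ) y u b) := by
    intro u a b
    have h1 := (hG.hasFDerivAt.clm_apply (hasFDerivAt_const a y)).clm_apply (hasFDerivAt_const b y)
    have hDa := hD.hasFDerivAt.clm_apply (hasFDerivAt_const a y)
    have hDb := hD.hasFDerivAt.clm_apply (hasFDerivAt_const b y)
    have h2 := ((hG'.hasFDerivAt.comp y hψ1).clm_apply hDa).clm_apply hDb
    have hev : (fun z => G z a b) =ᶠ[nhds y]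
        fun z => (G' ∘ ψ) z (fderiv ℝ ψ z a) (fderiv ℝ ψ z b) := by
      filter_upwards [hGG'] with z hz
      exact hz a b
    have h3 := congrArg (fun L => L u) ((h2.congr_of_eventuallyEq hev).unique h1)
    simp only [_root_.add_apply, ContinuousLinearMap.comp_apply, ContinuousLinearMap.flip_apply,
      _root_.zero_apply, map_zero, zero_add, Function.comp_apply] at h3
    linarith
  apply hnd
  intro w'
  obtain ⟨w, rfl⟩ := hsurj w'
  have h1 := hk' (fderiv ℝ ψ y u) (fderiv ℝ ψ y v) (fderiv ℝ ψ y w)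
  have h2 := hk u v w
  rw [hGG'.self_of_nhds, key, key, key, hs.eq w u, hs.eq w v, hs.eq v u,
    hsymm (fderiv ℝ ψ y v) (fderiv ℝ (fderiv ℝ ψ) y u w)] at h2
  rw [map_sub, _root_.sub_apply]
  linarith

section Change

variable {n : ℕ} {M : Type*} [TopologicalSpace M]
  [ChartedSpace (EuclideanSpace ℝ (Fin n)) M] [IsManifold (𝓡 n) ∞ M]

theorem gramL_eq_inner (g : RiemMetric n M) (c : M) (y a b : EuclideanSpace ℝ (Fin n)) :
    gramL g c y a b
      = g.inner ((extChartAt (𝓡 n) c).symm y) (ofCoord c y a) (ofCoord c y b) := by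
  rw [gramL_apply, inner_ofCoord]

theorem toCoord_ofCoord {c : M} {y : EuclideanSpace ℝ (Fin n)}
    (hy : y ∈ (extChartAt (𝓡 n) c).target) (a : EuclideanSpace ℝ (Fin n)) :
    toCoord c ((extChartAt (𝓡 n) c).symm y) (ofCoord c y a) = a :=
  vecCoord_ofCoord hy a

theorem ofCoord_toCoord {c : M} {y : EuclideanSpace ℝ (Fin n)}
    (hy : y ∈ (extChartAt (𝓡 n) c).target)
    (v : TangentSpace (𝓡 n) ((extChartAt (𝓡 n) c).symm y)) :
    ofCoord c y (toCoord c ((extChartAt (𝓡 n) c).symm y) v) = v :=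
  ofCoord_vecCoord hy v

theorem gramL_toCoord (g : RiemMetric n M) {c p : M}
    (hp : p ∈ (chartAt (EuclideanSpace ℝ (Fin n)) c).source) (v w : TangentSpace (𝓡 n) p) :
    gramL g c (extChartAt (𝓡 n) c p) (toCoord c p v) (toCoord c p w) = g.inner p v w := by
  have hp' : p ∈ (extChartAt (𝓡 n) c).source := by rwa [extChartAt_source]
  obtain ⟨y, hy, rfl⟩ : ∃ y ∈ (extChartAt (𝓡 n) c).target, (extChartAt (𝓡 n) c).symm y = p :=
    ⟨_, (extChartAt (𝓡 n) c).map_source hp', (extChartAt (𝓡 n) c).left_inv hp'⟩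
  rw [(extChartAt (𝓡 n) c).right_inv hy, gramL_eq_inner, ofCoord_toCoord hy, ofCoord_toCoord hy]

theorem toCoord_bijective {c p : M} (hp : p ∈ (chartAt (EuclideanSpace ℝ (Fin n)) c).source) :
    Function.Bijective (toCoord (n := n) c p) := by
  have hp' : p ∈ (extChartAt (𝓡 n) c).source := by rwa [extChartAt_source]
  exact (isInvertible_mfderiv_extChartAt (I := 𝓡 n) hp').bijective

theorem symm_mem_source {c : M} {y : EuclideanSpace ℝ (Fin n)}
    (hy : y ∈ (extChartAt (𝓡 n) c).target) :
    (extChartAt (𝓡 n) c).symm y ∈ (chartAt (EuclideanSpace ℝ (Fin n)) c).source := by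
  have := (extChartAt (𝓡 n) c).map_target hy
  rwa [extChartAt_source] at this

/-- The change of coordinates from the chart at `c` to the chart at `c'`. -/
def chartChange (c c' : M) (y : EuclideanSpace ℝ (Fin n)) : EuclideanSpace ℝ (Fin n) :=
  extChartAt (𝓡 n) c' ((extChartAt (𝓡 n) c).symm y)

/-- The coordinate domain, in the chart at `c`, of the overlap with the chart at `c'`. -/
def overlap (c c' : M) : Set (EuclideanSpace ℝ (Fin n)) :=
  (extChartAt (𝓡 n) c).target ∩
    (extChartAt (𝓡 n) c).symm ⁻¹' (chartAt (EuclideanSpace ℝ (Fin n)) c').source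

theorem isOpen_overlap (c c' : M) : IsOpen (overlap (n := n) c c') :=
  (continuousOn_extChartAt_symm c).isOpen_inter_preimage (isOpen_extChartAt_target c)
    (chartAt (EuclideanSpace ℝ (Fin n)) c').open_source

theorem contDiffOn_chartChange (c c' : M) :
    ContDiffOn ℝ ∞ (chartChange (n := n) c c') (overlap c c') := by
  rw [← contMDiffOn_iff_contDiffOn]
  exact (contMDiffOn_extChartAt (I := 𝓡 n) (n := ∞) (x := c')).comp
    ((contMDiffOn_extChartAt_symm (I := 𝓡 n) (n := ∞) c).mono Set.inter_subset_left)
    fun y hy => hy.2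

theorem contDiffAt_chartChange {c c' : M} {y : EuclideanSpace ℝ (Fin n)} (hy : y ∈ overlap c c') :
    ContDiffAt ℝ ∞ (chartChange (n := n) c c') y :=
  (contDiffOn_chartChange c c').contDiffAt ((isOpen_overlap c c').mem_nhds hy)

theorem toCoord_ofCoord_change {c c' : M} {y : EuclideanSpace ℝ (Fin n)} (hy : y ∈ overlap c c')
    (a : EuclideanSpace ℝ (Fin n)) :
    toCoord c' ((extChartAt (𝓡 n) c).symm y) (ofCoord c y a)
      = fderiv ℝ (chartChange c c') y a := by
  have h1 : MDifferentiableAt 𝓘(ℝ, EuclideanSpace ℝ (Fin n)) (𝓡 n) (extChartAt (𝓡 n) c).symm y := by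
    have := mdifferentiableWithinAt_extChartAt_symm (I := 𝓡 n) hy.1
    rwa [ModelWithCorners.range_eq_univ, mdifferentiableWithinAt_univ] at this
  have h2 := mfderiv_comp y (mdifferentiableAt_extChartAt (I := 𝓡 n) hy.2) h1
  have h3 := congrArg (fun L => L a) h2
  rw [← mfderiv_eq_fderiv]
  exact h3.symm

theorem chartChange_mem_target {c c' : M} {y : EuclideanSpace ℝ (Fin n)} (hy : y ∈ overlap c c') :
    chartChange c c' y ∈ (extChartAt (𝓡 n) c').target :=
  (extChartAt (𝓡 n) c').map_source (by rw [extChartAt_source]; exact hy.2)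

theorem gramL_chartChange (g : RiemMetric n M) {c c' : M} {y : EuclideanSpace ℝ (Fin n)}
    (hy : y ∈ overlap c c') (a b : EuclideanSpace ℝ (Fin n)) :
    gramL g c y a b = gramL g c' (chartChange c c' y) (fderiv ℝ (chartChange c c') y a)
      (fderiv ℝ (chartChange c c') y b) := by
  rw [← toCoord_ofCoord_change hy, ← toCoord_ofCoord_change hy, chartChange,
    gramL_toCoord g hy.2, gramL_eq_inner]

theorem fderiv_chartChange_surjective {c c' : M} {y : EuclideanSpace ℝ (Fin n)}
    (hy : y ∈ overlap c c') : Function.Surjective (fderiv ℝ (chartChange (n := n) c c') y) := by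
  intro w
  obtain ⟨v, hv⟩ := (toCoord_bijective hy.2).2 w
  exact ⟨toCoord c _ v, by rw [← toCoord_ofCoord_change hy, ofCoord_toCoord hy.1, hv]⟩

theorem chrL_chartChange (g : RiemMetric n M) {c c' : M} {y : EuclideanSpace ℝ (Fin n)}
    (hy : y ∈ overlap c c') (u v : EuclideanSpace ℝ (Fin n)) :
    chrL g c' (chartChange c c' y) (fderiv ℝ (chartChange c c') y u)
        (fderiv ℝ (chartChange c c') y v)
      = fderiv ℝ (chartChange c c') y (chrL g c y u v)
        - fderiv ℝ (fderiv ℝ (chartChange c c')) y u v :=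
  christoffel_change_of_koszul (differentiableAt_gramL g hy.1)
    (differentiableAt_gramL g (chartChange_mem_target hy)) (contDiffAt_chartChange hy)
    (Filter.eventually_of_mem ((isOpen_overlap c c').mem_nhds hy)
      fun _ hz => gramL_chartChange g hz)
    (gramL_symm g c' _) (fun _ _ h => eq_of_gramL_eq g (chartChange_mem_target hy) h)
    (fderiv_chartChange_surjective hy) (koszul g hy.1) (koszul g (chartChange_mem_target hy)) u v

end Change

/-! ### Parallel transport -/

/-- `IsParallelOn` takes the velocity of the base curve as a `derivWithin` and does not ask for
differentiability, so the chain rule must also hold for the default value 0: on one-point intervals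
and where `f` is not differentiable. The inverse affine map settles both cases. -/
theorem derivWithin_Icc_comp_affine {F : Type*} [NormedAddCommGroup F] [NormedSpace ℝ F]
    (f : ℝ → F) {α β a b a' b' : ℝ} (hα : α ≠ 0)
    (h : ∀ s, s ∈ Set.Icc a b ↔ α * s + β ∈ Set.Icc a' b') {t : ℝ} (ht : t ∈ Set.Icc a b) :
    derivWithin (fun s => f (α * s + β)) (Set.Icc a b) t
      = α • derivWithin f (Set.Icc a' b') (α * t + β) := by
  have hα' : α * α⁻¹ = 1 := mul_inv_cancel₀ hα
  have haff : ∀ (α β s : ℝ) (S : Set ℝ), HasDerivWithinAt (fun s => α * s + β) α S s := by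
    intro α β s S
    simpa using ((hasDerivWithinAt_id s S).const_mul α).add_const β
  rcases (ht.1.trans ht.2).eq_or_lt with hab | hab
  · subst hab
    have hsub : (Set.Icc a' b').Subsingleton := by
      intro x hx y hy
      have key : ∀ x ∈ Set.Icc a' b', α⁻¹ * (x - β) = a := by
        intro x hx
        have := (h (α⁻¹ * (x - β))).2 (by rwa [← mul_assoc, hα', one_mul, sub_add_cancel])
        exact le_antisymm this.2 this.1
      have e := (key x hx).trans (key y hy).symm
      have := mul_left_cancel₀ (inv_ne_zero hα) e
      linarith
    have hz : ∀ (f : ℝ → F) (S : Set ℝ) (x : ℝ), S.Subsingleton → derivWithin f S x = 0 := by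
      intro f S x hS
      exact derivWithin_zero_of_not_accPt fun hacc => Set.Infinite.of_accPt hacc hS.finite
    rw [hz _ _ _ (by simp), hz _ _ _ hsub, smul_zero]
  · have hu := uniqueDiffOn_Icc hab t ht
    by_cases hd : DifferentiableWithinAt ℝ f (Set.Icc a' b') (α * t + β)
    · exact (HasDerivWithinAt.scomp t hd.hasDerivWithinAt (haff α β t _)
        fun s hs => (h s).1 hs).derivWithin hu
    · rw [derivWithin_zero_of_not_differentiableWithinAt hd, smul_zero]
      apply derivWithin_zero_of_not_differentiableWithinAt
      intro hd'
      apply hd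
      have ht' : t = α⁻¹ * (α * t + β) + -(α⁻¹ * β) := by field_simp; ring
      have hd2 : DifferentiableWithinAt ℝ (fun s => f (α * s + β)) (Set.Icc a b)
          (α⁻¹ * (α * t + β) + -(α⁻¹ * β)) := by rwa [← ht']
      have h3 := DifferentiableWithinAt.comp (g := fun s => f (α * s + β))
        (f := fun s => α⁻¹ * s + -(α⁻¹ * β)) (t := Set.Icc a b) (s := Set.Icc a' b')
        (α * t + β) hd2
        (haff α⁻¹ (-(α⁻¹ * β)) (α * t + β) _).differentiableWithinAt (by
          intro s hs
          rw [h]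
          convert hs using 1
          field_simp; ring)
      refine h3.congr_of_eventuallyEq (Filter.Eventually.of_forall fun s => ?_) ?_
      · simp only [Function.comp_apply]; congr 1; field_simp; ring
      · simp only [Function.comp_apply]; congr 1; field_simp; ring

section Transport

variable {n : ℕ} {M : Type*} [TopologicalSpace M]
  [ChartedSpace (EuclideanSpace ℝ (Fin n)) M] [IsManifold (𝓡 n) ∞ M]

theorem IsParallelOn.congr {g : RiemMetric n M} {W W' : ℝ → TangentBundle (𝓡 n) M} {a b : ℝ}
    (h : IsParallelOn g W a b) (hW : ∀ s ∈ Set.Icc a b, W' s = W s) : IsParallelOn g W' a b := by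
  intro t ht c hc
  rw [hW t ht] at hc ⊢
  rw [derivWithin_congr (f := fun s => extChartAt (𝓡 n) c (W s).proj)
    (fun s hs => by simp only [hW s hs]) (by simp only [hW t ht])]
  exact (h t ht c hc).congr (fun s hs => by simp only [hW s hs]) (by simp only [hW t ht])

/-- The equation is linear in the velocity, so both sides scale by `α`. -/
theorem IsParallelOn.comp_affine {g : RiemMetric n M} {W : ℝ → TangentBundle (𝓡 n) M}
    {α β a b a' b' : ℝ} (hα : α ≠ 0) (h : IsParallelOn g W a' b')
    (hab : ∀ s, s ∈ Set.Icc a b ↔ α * s + β ∈ Set.Icc a' b') :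
    IsParallelOn g (fun s => W (α * s + β)) a b := by
  intro t ht c hc
  have h1 := h _ ((hab t).1 ht) c hc
  have h2 : HasDerivWithinAt (fun s => α * s + β) α (Set.Icc a b) t := by
    simpa using ((hasDerivWithinAt_id t (Set.Icc a b)).const_mul α).add_const β
  have h3 := HasDerivWithinAt.scomp t h1 h2 fun s hs => (hab s).1 hs
  rw [derivWithin_Icc_comp_affine (fun s => extChartAt (𝓡 n) c (W s).proj) hα hab ht]
  convert! h3 using 1
  simp only [← chrL_apply, map_smul, _root_.smul_apply, smul_neg]

theorem ContMDiffOn.comp_affine {f : ℝ → M} {α β a b a' b' : ℝ}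
    (h : ContMDiffOn 𝓘(ℝ, ℝ) (𝓡 n) 1 f (Set.Icc a' b'))
    (hab : ∀ s, s ∈ Set.Icc a b ↔ α * s + β ∈ Set.Icc a' b') :
    ContMDiffOn 𝓘(ℝ, ℝ) (𝓡 n) 1 (fun s => f (α * s + β)) (Set.Icc a b) := by
  have haff : ContMDiff 𝓘(ℝ, ℝ) 𝓘(ℝ, ℝ) 1 fun s : ℝ => α * s + β :=
    (by fun_prop : ContDiff ℝ 1 fun s : ℝ => α * s + β).contMDiff
  exact h.comp haff.contMDiffOn fun s hs => (hab s).1 hs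

theorem IsParallelTransport.symm {g : RiemMetric n M} {p q : M} {γ : Path p q}
    {v : TangentSpace (𝓡 n) p} {w : TangentSpace (𝓡 n) q} (h : IsParallelTransport g γ v w) :
    IsParallelTransport g γ.symm w v := by
  obtain ⟨W, hW, hW0, hW1, m, t, hmono, ht0, htm, hi⟩ := h
  -- Truncated subtraction keeps the reversed partition constant, equal to 1, after index `m`, so it
  -- stays monotone on all of `ℕ`.
  refine ⟨fun s => W (-1 * s + 1), fun s hs => ?_, by simpa using hW1, by simpa using hW0, m,
    fun i => 1 - t (m - i), fun i j hij => ?_, by simp [htm], by simp [ht0], fun i him => ?_⟩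
  · rw [hW _ ⟨by linarith [hs.2], by linarith [hs.1]⟩, Path.extend_symm_apply]
    congr 1; ring
  · have := hmono (Nat.sub_le_sub_left hij m)
    simp only; linarith
  · have e : m - i = m - (i + 1) + 1 := by omega
    have h1 := hi (m - (i + 1)) (by omega)
    rw [← e] at h1
    have hab : ∀ s : ℝ, s ∈ Set.Icc (1 - t (m - i)) (1 - t (m - (i + 1))) ↔
        -1 * s + 1 ∈ Set.Icc (t (m - (i + 1))) (t (m - i)) := by
      intro s
      simp only [Set.mem_Icc]
      constructor <;> rintro ⟨h, h'⟩ <;> constructor <;> linarith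
    refine ⟨(ContMDiffOn.comp_affine h1.1 hab).congr fun s _ => ?_,
      h1.2.comp_affine (by norm_num) hab⟩
    rw [Path.extend_symm_apply]
    congr 1; ring

theorem IsParallelTransport.trans {g : RiemMetric n M} {p q r : M} {γ : Path p q} {σ : Path q r}
    {v : TangentSpace (𝓡 n) p} {w : TangentSpace (𝓡 n) q} {z : TangentSpace (𝓡 n) r}
    (h : IsParallelTransport g γ v w) (h' : IsParallelTransport g σ w z) :
    IsParallelTransport g (γ.trans σ) v z := by
  obtain ⟨W, hW, hW0, hW1, m, t, hmono, ht0, htm, hi⟩ := h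
  obtain ⟨W', hW', hW0', hW1', m', t', hmono', ht0', htm', hi'⟩ := h'
  have ht'0 : ∀ k, 0 ≤ t' k := fun k => ht0' ▸ hmono' (Nat.zero_le k)
  -- At `s = 1 / 2` both branches give the common vector `w`, so the second formula is valid on the
  -- closed right half.
  have hright : ∀ s : ℝ, 1 / 2 ≤ s →
      (if s ≤ 1 / 2 then W (2 * s + 0) else W' (2 * s + -1)) = W' (2 * s + -1) := by
    intro s hs
    split_ifs with h
    · have : s = 1 / 2 := le_antisymm h hs
      subst this
      norm_num [hW1, hW0']
    · rfl
  refine ⟨fun s => if s ≤ 1 / 2 then W (2 * s + 0) else W' (2 * s + -1), fun s hs => ?_,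
    by simpa using hW0, ?_, m + m',
    fun i => if i ≤ m then t i / 2 else 1 / 2 + t' (i - m) / 2, fun i j hij => ?_, ?_, ?_,
    fun i him => ?_⟩
  · dsimp only
    rcases le_total s (1 / 2) with h | h
    · rw [if_pos h, Path.extend_trans_of_le_half _ _ h,
        hW _ ⟨by linarith [hs.1], by linarith⟩, add_zero]
    · rw [hright s h, Path.extend_trans_of_half_le _ _ h,
        hW' _ ⟨by linarith, by linarith [hs.2]⟩, sub_eq_add_neg]
  · dsimp only
    rw [hright 1 (by norm_num)]
    norm_num [hW1']
  · dsimp only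
    split_ifs with h1 h2 h2
    · linarith [hmono hij]
    · have := hmono h1
      have := ht'0 (j - m)
      linarith
    · omega
    · linarith [hmono' (Nat.sub_le_sub_right hij m)]
  · simp [ht0]
  · dsimp only
    rcases Nat.eq_zero_or_pos m' with h0 | h0
    · subst h0; rw [ht0'] at htm'; norm_num at htm'
    · rw [if_neg (by omega), Nat.add_sub_cancel_left, htm']; norm_num
  · dsimp only
    rcases lt_or_ge i m with h1 | h1
    · rw [if_pos h1.le, if_pos (by omega : i + 1 ≤ m)]
      have htle : t (i + 1) ≤ 1 := htm ▸ hmono (by omega : i + 1 ≤ m)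
      have hab : ∀ s : ℝ, s ∈ Set.Icc (t i / 2) (t (i + 1) / 2) ↔
          2 * s + 0 ∈ Set.Icc (t i) (t (i + 1)) := by
        intro s
        simp only [Set.mem_Icc]
        constructor <;> rintro ⟨h, h'⟩ <;> constructor <;> linarith
      refine ⟨(ContMDiffOn.comp_affine (hi i h1).1 hab).congr fun s hs => ?_,
        ((hi i h1).2.comp_affine two_ne_zero hab).congr fun s hs => ?_⟩
      · rw [Path.extend_trans_of_le_half _ _ (by linarith [hs.2]), add_zero]
      · rw [if_pos (by linarith [hs.2])]
    -- For `i = m` the two branches agree, as `t m = 1` and `t' 0 = 0`.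
    · have e1 : (if i ≤ m then t i / 2 else 1 / 2 + t' (i - m) / 2) = 1 / 2 + t' (i - m) / 2 := by
        split_ifs with h2
        · have : i = m := le_antisymm h2 h1
          subst this
          rw [htm, Nat.sub_self, ht0']; norm_num
        · rfl
      rw [e1, if_neg (by omega : ¬ i + 1 ≤ m), show i + 1 - m = i - m + 1 by omega]
      have h2 := hi' (i - m) (by omega)
      have := ht'0 (i - m)
      have hab : ∀ s : ℝ, s ∈ Set.Icc (1 / 2 + t' (i - m) / 2) (1 / 2 + t' (i - m + 1) / 2) ↔
          2 * s + -1 ∈ Set.Icc (t' (i - m)) (t' (i - m + 1)) := by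
        intro s
        simp only [Set.mem_Icc]
        constructor <;> rintro ⟨h, h'⟩ <;> constructor <;> linarith
      refine ⟨(ContMDiffOn.comp_affine h2.1 hab).congr fun s hs => ?_,
        (h2.2.comp_affine two_ne_zero hab).congr fun s hs => ?_⟩
      · rw [Path.extend_trans_of_half_le _ _ (by linarith [hs.1]), sub_eq_add_neg]
      · rw [hright s (by linarith [hs.1])]

/-- The subspace `V` of `T_x M` is invariant under the restricted holonomy group. -/
def IsHolonomyInvariant (g : RiemMetric n M) (x : M) (V : Submodule ℝ (TangentSpace (𝓡 n) x)) :
    Prop :=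
  ∀ P ∈ restrictedHolonomy g x, ∀ v ∈ V, P v ∈ V

/-- Conjugating a null-homotopic loop at `q` by `γ` gives a null-homotopic loop at `p`, whose
transport preserves `V`. -/
theorem IsHolonomyInvariant.map {g : RiemMetric n M} {p q : M} (γ : Path p q)
    (P : TangentSpace (𝓡 n) p ≃ₗ[ℝ] TangentSpace (𝓡 n) q)
    (hP : ∀ v, IsParallelTransport g γ v (P v)) {V : Submodule ℝ (TangentSpace (𝓡 n) p)}
    (hV : IsHolonomyInvariant g p V) : IsHolonomyInvariant g q (V.map P.toLinearMap) := by
  rintro Q ⟨σ, hσ, hQ⟩ _ ⟨v, hv, rfl⟩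
  have hmem : (P.symm.toLinearMap ∘ₗ Q ∘ₗ P.toLinearMap) ∈ restrictedHolonomy g p := by
    refine ⟨(γ.trans σ).trans γ.symm, ?_, fun v => ?_⟩
    · have h1 : (γ.trans σ).Homotopic γ :=
        (Path.Homotopic.hcomp (Path.Homotopic.refl γ) hσ).trans ⟨Path.Homotopy.transRefl γ⟩
      exact (Path.Homotopic.hcomp h1 (Path.Homotopic.refl γ.symm)).trans
        ⟨(Path.Homotopy.reflTransSymm γ).symm⟩
    · refine ((hP v).trans (hQ (P v))).trans ?_
      have h2 := (hP (P.symm (Q (P v)))).symm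
      rwa [P.apply_symm_apply] at h2
  exact ⟨_, hV _ hmem v hv, P.apply_symm_apply _⟩

end Transport

/-! ### Parallel transport along coordinate segments -/

/-- Linear differential equations with small coefficients in a Banach algebra are solvable on the
unit interval. -/
theorem exists_linear_ode_solution {R : Type*} [NormedRing R] [NormedAlgebra ℝ R] [CompleteSpace R]
    {A : ℝ → R} (hA : ContinuousOn A (Set.Icc 0 1)) (hb : ∀ s ∈ Set.Icc (0 : ℝ) 1, ‖A s‖ ≤ 1 / 2) :
    ∃ Φ : ℝ → R, Φ 0 = 1 ∧
      ∀ s ∈ Set.Icc (0 : ℝ) 1, HasDerivWithinAt Φ (A s * Φ s) (Set.Icc 0 1) s := by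
  -- On the ball of radius `‖1‖` about `1` one has `‖x‖ ≤ 2 ‖1‖`, so the field is bounded by `‖1‖`
  -- and the solution cannot leave the ball within unit time.
  have hPL : IsPicardLindelof (fun s (x : R) => A s * x) (tmin := 0) (tmax := 1)
      ⟨0, by simp⟩ (1 : R) ‖(1 : R)‖₊ 0 ‖(1 : R)‖₊ (1 / 2) := by
    refine ⟨fun s hs => ?_, fun x _ => hA.mul continuousOn_const, fun s hs x hx => ?_, ?_⟩
    · refine LipschitzOnWith.of_dist_le_mul fun x _ y _ => ?_
      rw [dist_eq_norm, dist_eq_norm, ← mul_sub]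
      refine (norm_mul_le _ _).trans (mul_le_mul_of_nonneg_right ?_ (norm_nonneg _))
      simpa using hb s hs
    · have h1 : ‖x‖ ≤ 2 * ‖(1 : R)‖ := by
        have h2 := mem_closedBall_iff_norm.1 hx
        have h3 := norm_le_norm_add_norm_sub' x (1 : R)
        simp only [coe_nnnorm] at h2
        linarith
      calc ‖A s * x‖ ≤ ‖A s‖ * ‖x‖ := norm_mul_le _ _
        _ ≤ 1 / 2 * (2 * ‖(1 : R)‖) :=
          mul_le_mul (hb s hs) h1 (norm_nonneg _) (by norm_num)
        _ = ‖(1 : R)‖₊ := by rw [coe_nnnorm]; ring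
    · simp
  exact hPL.exists_eq_forall_mem_Icc_hasDerivWithinAt₀

section Segments

variable {n : ℕ} {M : Type*} [TopologicalSpace M]
  [ChartedSpace (EuclideanSpace ℝ (Fin n)) M] [IsManifold (𝓡 n) ∞ M]

/-- `L` is, in the chart at `c`, the parallel transport along the segment from `a` to `b`. -/
def IsTransportMap (g : RiemMetric n M) (c : M) (a b : EuclideanSpace ℝ (Fin n))
    (L : EuclideanSpace ℝ (Fin n) →L[ℝ] EuclideanSpace ℝ (Fin n)) : Prop :=
  ∃ Φ : ℝ → (EuclideanSpace ℝ (Fin n) →L[ℝ] EuclideanSpace ℝ (Fin n)), Φ 0 = 1 ∧ Φ 1 = L ∧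
    ∀ s ∈ Set.Icc (0 : ℝ) 1,
      HasDerivWithinAt Φ (-chrL g c (a + s • (b - a)) (b - a) * Φ s) (Set.Icc 0 1) s

/-- An open convex set in the domain of coordinates of the chart at `c` which is so small that
parallel transport along its segments can be found by Picard iteration. -/
structure IsSmall (g : RiemMetric n M) (c : M) (B : Set (EuclideanSpace ℝ (Fin n))) (K : ℝ) :
    Prop where
  isOpen : IsOpen B
  convex : Convex ℝ B
  subset : B ⊆ (extChartAt (𝓡 n) c).target
  norm_le : ∀ y ∈ B, ‖chrL g c y‖ ≤ K
  mul_le : ∀ y ∈ B, ∀ z ∈ B, K * ‖y - z‖ ≤ 1 / 2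

theorem exists_isSmall (g : RiemMetric n M) (c : M) :
    ∃ B K, IsSmall g c B K ∧ extChartAt (𝓡 n) c c ∈ B := by
  have hy : extChartAt (𝓡 n) c c ∈ (extChartAt (𝓡 n) c).target := mem_extChartAt_target c
  have hc : ContinuousAt (fun z => ‖chrL g c z‖) (extChartAt (𝓡 n) c c) :=
    (differentiableAt_chrL g hy).continuousAt.norm
  set K := ‖chrL g c (extChartAt (𝓡 n) c c)‖ + 1 with hK
  have hK0 : 0 < K := by positivity
  have hev := (hc.eventually_lt continuousAt_const (lt_add_one _)).and
    ((isOpen_extChartAt_target (I := 𝓡 n) c).mem_nhds hy)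
  obtain ⟨r, hr, hball⟩ := Metric.eventually_nhds_iff_ball.1 hev
  -- Two points of a ball of radius `1 / (4 * K)` are less than `1 / (2 * K)` apart, as
  -- `IsSmall.mul_le` requires.
  refine ⟨Metric.ball (extChartAt (𝓡 n) c c) (min r (1 / (4 * K))), K,
    ⟨Metric.isOpen_ball, convex_ball _ _, fun y hy => ?_, fun y hy => ?_, fun y hy z hz => ?_⟩, ?_⟩
  · exact (hball y (Metric.ball_subset_ball (min_le_left _ _) hy)).2
  · exact (hball y (Metric.ball_subset_ball (min_le_left _ _) hy)).1.le
  · have h1 := (Metric.mem_ball.1 hy).trans_le (min_le_right _ _)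
    have h2 := (Metric.mem_ball.1 hz).trans_le (min_le_right _ _)
    have h3 := dist_triangle_right y z (extChartAt (𝓡 n) c c)
    rw [dist_eq_norm y z] at h3
    have h4 : K * (1 / (4 * K)) = 1 / 4 := by field_simp
    nlinarith
  · exact Metric.mem_ball_self (by positivity)

theorem IsSmall.segment_mem {g : RiemMetric n M} {c : M} {B : Set (EuclideanSpace ℝ (Fin n))}
    {K : ℝ} (hB : IsSmall g c B K) {a b : EuclideanSpace ℝ (Fin n)} (ha : a ∈ B) (hb : b ∈ B)
    {s : ℝ} (hs : s ∈ Set.Icc (0 : ℝ) 1) : a + s • (b - a) ∈ B :=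
  hB.convex.add_smul_sub_mem ha hb hs

theorem IsSmall.exists_isTransportMap {g : RiemMetric n M} {c : M}
    {B : Set (EuclideanSpace ℝ (Fin n))} {K : ℝ} (hB : IsSmall g c B K)
    {a b : EuclideanSpace ℝ (Fin n)} (ha : a ∈ B) (hb : b ∈ B) : ∃ L, IsTransportMap g c a b L := by
  obtain ⟨Φ, h0, h1⟩ := exists_linear_ode_solution
    (A := fun s => -chrL g c (a + s • (b - a)) (b - a)) (by
      intro s hs
      have h1 := (differentiableAt_chrL g (hB.subset (hB.segment_mem ha hb hs))).continuousAt
      have h2 : ContinuousAt (fun s : ℝ => a + s • (b - a)) s := by fun_prop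
      have h3 : ContinuousAt (fun s : ℝ => chrL g c (a + s • (b - a))) s :=
        ContinuousAt.comp (f := fun s : ℝ => a + s • (b - a)) h1 h2
      exact (h3.clm_apply continuousAt_const).neg.continuousWithinAt) (by
      intro s hs
      rw [norm_neg]
      refine ((chrL g c _).le_opNorm _).trans ?_
      exact (mul_le_mul_of_nonneg_right (hB.norm_le _ (hB.segment_mem ha hb hs))
        (norm_nonneg _)).trans (hB.mul_le _ hb _ ha))
  exact ⟨Φ 1, Φ, h0, rfl, h1⟩

theorem hasDerivWithinAt_segment (a b : EuclideanSpace ℝ (Fin n)) (S : Set ℝ) (s : ℝ) :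
    HasDerivWithinAt (fun s : ℝ => a + s • (b - a)) (b - a) S s := by
  simpa using ((hasDerivWithinAt_id s S).smul_const (b - a)).const_add a

theorem neg_mul_clm_apply {E : Type*} [NormedAddCommGroup E] [NormedSpace ℝ E] (A B : E →L[ℝ] E)
    (v : E) : (-A * B) v = -A (B v) := rfl

/-- By metric compatibility, the inner product of two parallel fields has zero derivative along the
segment. -/
theorem IsTransportMap.gramL_eq {g : RiemMetric n M} {c : M} {a b : EuclideanSpace ℝ (Fin n)}
    {L : EuclideanSpace ℝ (Fin n) →L[ℝ] EuclideanSpace ℝ (Fin n)} (hL : IsTransportMap g c a b L)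
    (hseg : ∀ s ∈ Set.Icc (0 : ℝ) 1, a + s • (b - a) ∈ (extChartAt (𝓡 n) c).target)
    (v w : EuclideanSpace ℝ (Fin n)) : gramL g c b (L v) (L w) = gramL g c a v w := by
  obtain ⟨Φ, h0, h1, hΦ⟩ := hL
  have hd : ∀ s ∈ Set.Icc (0 : ℝ) 1, HasDerivWithinAt
      (fun s => gramL g c (a + s • (b - a)) (Φ s v) (Φ s w)) 0 (Set.Icc 0 1) s := by
    intro s hs
    have hG := (differentiableAt_gramL g (hseg s hs)).hasFDerivAt.comp_hasDerivWithinAt s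
      (hasDerivWithinAt_segment a b (Set.Icc 0 1) s)
    have hv := (hΦ s hs).clm_apply (hasDerivWithinAt_const s (Set.Icc 0 1) v)
    have hw := (hΦ s hs).clm_apply (hasDerivWithinAt_const s (Set.Icc 0 1) w)
    have h := (hG.clm_apply hv).clm_apply hw
    convert! h using 1
    simp only [map_zero, add_zero, _root_.add_apply, Function.comp_apply,
      neg_mul_clm_apply, _root_.neg_apply, map_neg, fderiv_gramL g (hseg s hs)]
    ring
  have hconst := constant_of_derivWithin_zero (fun s hs => (hd s hs).differentiableWithinAt)
    (fun s hs => (hd s ⟨hs.1, hs.2.le⟩).derivWithin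
      (uniqueDiffOn_Icc zero_lt_one s ⟨hs.1, hs.2.le⟩)) 1 (by simp)
  simpa [h0, h1] using hconst

theorem IsTransportMap.restrict {g : RiemMetric n M} {c : M} {a b : EuclideanSpace ℝ (Fin n)}
    {Φ : ℝ → (EuclideanSpace ℝ (Fin n) →L[ℝ] EuclideanSpace ℝ (Fin n))} (h0 : Φ 0 = 1)
    (hΦ : ∀ s ∈ Set.Icc (0 : ℝ) 1,
      HasDerivWithinAt Φ (-chrL g c (a + s • (b - a)) (b - a) * Φ s) (Set.Icc 0 1) s)
    {t : ℝ} (ht : t ∈ Set.Icc (0 : ℝ) 1) : IsTransportMap g c a (a + t • (b - a)) (Φ t) := by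
  refine ⟨fun s => Φ (t * s), by simpa using h0, by simp, fun s hs => ?_⟩
  have hmaps : Set.MapsTo (fun s => t * s) (Set.Icc (0 : ℝ) 1) (Set.Icc 0 1) := fun s hs =>
    ⟨mul_nonneg ht.1 hs.1, mul_le_one₀ ht.2 hs.1 hs.2⟩
  have h2 : HasDerivWithinAt (fun s => t * s) t (Set.Icc 0 1) s := by
    simpa using (hasDerivWithinAt_id s (Set.Icc (0 : ℝ) 1)).const_mul t
  have h3 := HasDerivWithinAt.scomp s (hΦ _ (hmaps hs)) h2 hmaps
  convert! h3 using 1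
  rw [add_sub_cancel_left, smul_smul, mul_comm s t, map_smul, neg_mul, neg_mul, smul_neg,
    smul_mul_assoc]

/-- The equation is solved in the chart at `c` but is required in every chart. The derivative of the
Jacobian of the chart change along the curve cancels the inhomogeneous term of `chrL_chartChange`.
-/
theorem isParallelOn_segment (g : RiemMetric n M) (c : M) {a b : EuclideanSpace ℝ (Fin n)}
    (hseg : ∀ s ∈ Set.Icc (0 : ℝ) 1, a + s • (b - a) ∈ (extChartAt (𝓡 n) c).target)
    {Φ : ℝ → (EuclideanSpace ℝ (Fin n) →L[ℝ] EuclideanSpace ℝ (Fin n))}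
    (hΦ : ∀ s ∈ Set.Icc (0 : ℝ) 1,
      HasDerivWithinAt Φ (-chrL g c (a + s • (b - a)) (b - a) * Φ s) (Set.Icc 0 1) s)
    (v : EuclideanSpace ℝ (Fin n)) :
    IsParallelOn g (fun s => ⟨(extChartAt (𝓡 n) c).symm (a + s • (b - a)),
      ofCoord c (a + s • (b - a)) (Φ s v)⟩) 0 1 := by
  intro t ht c' hc'
  have hov : a + t • (b - a) ∈ overlap c c' := ⟨hseg t ht, hc'⟩
  have hz := hasDerivWithinAt_segment a b (Set.Icc 0 1) t
  have hψ := contDiffAt_chartChange hov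
  have hD : DifferentiableAt ℝ (fderiv ℝ (chartChange c c')) (a + t • (b - a)) :=
    (hψ.fderiv_right (m := ∞) (by simp)).differentiableAt (by simp)
  have hbase := ((hψ.differentiableAt (by simp)).hasFDerivAt.comp_hasDerivWithinAt t hz).derivWithin
    (uniqueDiffOn_Icc zero_lt_one t ht)
  have hDz := hD.hasFDerivAt.comp_hasDerivWithinAt t hz
  have hv := (hΦ t ht).clm_apply (hasDerivWithinAt_const t (Set.Icc 0 1) v)
  have h := hDz.clm_apply hv
  have hev : (fun s => vecCoord c' (⟨(extChartAt (𝓡 n) c).symm (a + s • (b - a)),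
      ofCoord c (a + s • (b - a)) (Φ s v)⟩ : TangentBundle (𝓡 n) M))
      =ᶠ[nhdsWithin t (Set.Icc 0 1)]
      fun s => (fderiv ℝ (chartChange c c') ∘ fun s : ℝ => a + s • (b - a)) s (Φ s v) := by
    filter_upwards [hz.continuousWithinAt.eventually ((isOpen_overlap c c').mem_nhds hov)] with s hs
    exact toCoord_ofCoord_change hs _
  have h' := h.congr_of_eventuallyEq hev (toCoord_ofCoord_change hov _)
  convert! h' using 1
  rw [← chrL_apply]
  change -chrL g c' (chartChange c c' (a + t • (b - a)))
    (derivWithin (chartChange c c' ∘ fun s : ℝ => a + s • (b - a)) (Set.Icc 0 1) t)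
    (toCoord c' _ (ofCoord c (a + t • (b - a)) (Φ t v))) = _
  rw [hbase, toCoord_ofCoord_change hov, chrL_chartChange g hov]
  simp only [map_zero, add_zero, Function.comp_apply, neg_mul_clm_apply, map_neg]
  abel

/-- The straight path between two points of a convex set. -/
def segPath {B : Set (EuclideanSpace ℝ (Fin n))} (hB : Convex ℝ B) (a b : B) : Path a b where
  toFun s := ⟨a.1 + s.1 • (b.1 - a.1), hB.add_smul_sub_mem a.2 b.2 s.2⟩
  continuous_toFun := by fun_prop
  source' := by simp
  target' := by simp

/-- The inverse chart at `c` on a subset of the coordinate domain. -/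
def chartInv (c : M) (B : Set (EuclideanSpace ℝ (Fin n))) (y : B) : M :=
  (extChartAt (𝓡 n) c).symm y.1

theorem continuous_chartInv {c : M} {B : Set (EuclideanSpace ℝ (Fin n))}
    (hB : B ⊆ (extChartAt (𝓡 n) c).target) : Continuous (chartInv (n := n) c B) :=
  ((continuousOn_extChartAt_symm (I := 𝓡 n) c).mono hB).domRestrict

theorem IsSmall.isParallelTransport {g : RiemMetric n M} {c : M}
    {B : Set (EuclideanSpace ℝ (Fin n))} {K : ℝ} (hB : IsSmall g c B K) {a b : B}
    {L : EuclideanSpace ℝ (Fin n) →L[ℝ] EuclideanSpace ℝ (Fin n)} (hL : IsTransportMap g c a b L)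
    (v : EuclideanSpace ℝ (Fin n)) :
    IsParallelTransport g ((segPath hB.convex a b).map (continuous_chartInv hB.subset))
      (ofCoord c a.1 v : TangentSpace (𝓡 n) (chartInv c B a))
      (ofCoord c b.1 (L v) : TangentSpace (𝓡 n) (chartInv c B b)) := by
  obtain ⟨Φ, h0, h1, hΦ⟩ := hL
  have hseg : ∀ s ∈ Set.Icc (0 : ℝ) 1, a.1 + s • (b.1 - a.1) ∈ (extChartAt (𝓡 n) c).target :=
    fun s hs => hB.subset (hB.segment_mem a.2 b.2 hs)
  have hγ : ∀ s ∈ Set.Icc (0 : ℝ) 1,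
      ((segPath hB.convex a b).map (continuous_chartInv hB.subset)).extend s
        = (extChartAt (𝓡 n) c).symm (a.1 + s • (b.1 - a.1)) := by
    intro s hs
    rw [Path.extend_apply _ hs]
    rfl
  refine ⟨fun s => ⟨(extChartAt (𝓡 n) c).symm (a.1 + s • (b.1 - a.1)),
      ofCoord c (a.1 + s • (b.1 - a.1)) (Φ s v)⟩, fun s hs => (hγ s hs).symm, ?_, ?_, 1,
      fun i => (i : ℝ), Nat.mono_cast, by simp, by simp, ?_⟩
  · have e : a.1 + (0 : ℝ) • (b.1 - a.1) = a.1 := by simp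
    dsimp only
    rw [e, h0]
    rfl
  · have e : a.1 + (1 : ℝ) • (b.1 - a.1) = b.1 := by simp
    dsimp only
    rw [e, h1]
    rfl
  · intro i hi
    obtain rfl : i = 0 := by omega
    simp only [Nat.cast_zero, zero_add, Nat.cast_one]
    refine ⟨?_, isParallelOn_segment g c hseg hΦ v⟩
    refine ContMDiffOn.congr ?_ hγ
    have h2 : ContMDiff 𝓘(ℝ, ℝ) 𝓘(ℝ, EuclideanSpace ℝ (Fin n)) 1
        fun s : ℝ => a.1 + s • (b.1 - a.1) :=
      (by fun_prop : ContDiff ℝ 1 fun s : ℝ => a.1 + s • (b.1 - a.1)).contMDiff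
    exact (contMDiffOn_extChartAt_symm (I := 𝓡 n) (n := 1) c).comp h2.contMDiffOn hseg

end Segments

/-! ### Parallel endomorphism fields -/

section BanachAlgebra

variable {E R : Type*} [NormedAddCommGroup E] [NormedSpace ℝ E] [NormedRing R] [NormedAlgebra ℝ R]

/-- The commutator `u ↦ p A(u) - A(u) p`. -/
def commL (p : R) (A : E →L[ℝ] R) : E →L[ℝ] R :=
  (ContinuousLinearMap.mul ℝ R p).comp A - ((ContinuousLinearMap.mul ℝ R).flip p).comp A

theorem commL_apply (p : R) (A : E →L[ℝ] R) (u : E) : commL p A u = p * A u - A u * p := rfl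

/-- The integrability condition for a field `p` with `dp = [p, A]`: it commutes with the curvature
of `A`. -/
theorem commute_curvature_of_hasFDerivAt {p : E → R} {A : E → E →L[ℝ] R} {y : E}
    (hA : DifferentiableAt ℝ A y) (hp : ∀ᶠ z in nhds y, HasFDerivAt p (commL (p z) (A z)) z)
    (u v : E) :
    p y * (fderiv ℝ A y u v - fderiv ℝ A y v u + (A y u * A y v - A y v * A y u))
      = (fderiv ℝ A y u v - fderiv ℝ A y v u + (A y u * A y v - A y v * A y u)) * p y := by
  have hp1 := hp.self_of_nhds
  have h1 := ((ContinuousLinearMap.mul ℝ R).hasFDerivAt.comp y hp1).clm_comp hA.hasFDerivAt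
  have h2 := ((ContinuousLinearMap.mul ℝ R).flip.hasFDerivAt.comp y hp1).clm_comp hA.hasFDerivAt
  -- Differentiating `dp = [p, A]` and substituting it back expresses `D²p` through `p`, `A` and
  -- `dA`; its symmetry is the claimed commutation.
  have h3 := second_derivative_symmetric_of_eventually (𝕜 := ℝ) hp (h1.sub h2) u v
  simp only [_root_.sub_apply, _root_.add_apply, ContinuousLinearMap.comp_apply,
    ContinuousLinearMap.flip_apply, ContinuousLinearMap.compL_apply, commL_apply,
    ContinuousLinearMap.mul_apply', Function.comp_apply, mul_sub, sub_mul, mul_add, add_mul,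
    mul_assoc] at h3 ⊢
  rw [← sub_eq_zero] at h3 ⊢
  rw [← h3]
  abel

/-- A field satisfying `p' = [p, A]` along segments is continuously differentiable. -/
theorem hasFDerivAt_of_segments {p : E → R} {A : E → E →L[ℝ] R} {B : Set E} {K : ℝ}
    (hBo : IsOpen B) (hBc : Convex ℝ B) (hA : ContinuousOn A B) (hK : ∀ y ∈ B, ‖A y‖ ≤ K)
    (hp : ∀ a ∈ B, ∀ b ∈ B, ∀ t ∈ Set.Icc (0 : ℝ) 1,
      HasDerivWithinAt (fun t : ℝ => p (a + t • (b - a)))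
        (commL (p (a + t • (b - a))) (A (a + t • (b - a))) (b - a)) (Set.Icc 0 1) t)
    (hsmall : ∀ y ∈ B, ∀ z ∈ B, K * ‖y - z‖ ≤ 1 / 2) {y : E} (hy : y ∈ B) :
    HasFDerivAt p (commL (p y) (A y)) y := by
  have hK0 : 0 ≤ K := (norm_nonneg _).trans (hK y hy)
  have hseg : ∀ a ∈ B, ∀ b ∈ B, ∀ t ∈ Set.Icc (0 : ℝ) 1, a + t • (b - a) ∈ B :=
    fun a ha b hb t ht => hBc.add_smul_sub_mem ha hb ht
  have hcomm : ∀ z ∈ B, ∀ u, ‖commL (p z) (A z) u‖ ≤ 2 * (K * ‖u‖) * ‖p z‖ := by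
    intro z hz u
    have h1 : ‖A z u‖ ≤ K * ‖u‖ :=
      ((A z).le_opNorm u).trans (mul_le_mul_of_nonneg_right (hK z hz) (norm_nonneg _))
    calc ‖commL (p z) (A z) u‖ ≤ ‖p z * A z u‖ + ‖A z u * p z‖ := norm_sub_le _ _
      _ ≤ ‖p z‖ * ‖A z u‖ + ‖A z u‖ * ‖p z‖ := add_le_add (norm_mul_le _ _) (norm_mul_le _ _)
      _ ≤ 2 * (K * ‖u‖) * ‖p z‖ := by nlinarith [norm_nonneg (p z)]
  -- Grönwall along the segment, with rate `2 * (K * ‖b - y‖) ≤ 1`. No continuity of `p` across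
  -- segments is known yet: this bound gives the Lipschitz estimate `hlip` at `y`, hence continuity
  -- of the candidate derivative, and the mean value inequality then gives differentiability.
  have hbdd : ∀ b ∈ B, ‖p b‖ ≤ ‖p y‖ * Real.exp 1 := by
    intro b hb
    have h1 := norm_le_gronwallBound_of_norm_deriv_right_le
      (f := fun t : ℝ => p (y + t • (b - y)))
      (f' := fun t : ℝ => commL (p (y + t • (b - y))) (A (y + t • (b - y))) (b - y))
      (δ := ‖p y‖) (K := 2 * (K * ‖b - y‖)) (ε := 0) (a := 0) (b := 1)
      (fun t ht => (hp y hy b hb t ht).continuousWithinAt)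
      (fun t ht => ((hp y hy b hb t ⟨ht.1, ht.2.le⟩).mono_of_mem_nhdsWithin
        (Icc_mem_nhdsGE_of_mem ht)))
      (by simp)
      (fun t ht => by
        rw [add_zero]
        exact hcomm _ (hseg y hy b hb t ⟨ht.1, ht.2.le⟩) _) 1 (by simp)
    rw [gronwallBound_ε0] at h1
    simp only [one_smul, add_sub_cancel, sub_zero, mul_one] at h1
    refine h1.trans (mul_le_mul_of_nonneg_left (Real.exp_le_exp.2 ?_) (norm_nonneg _))
    linarith [hsmall b hb y hy]
  have hlip : ∀ b ∈ B, ‖p b - p y‖ ≤ 2 * (K * ‖b - y‖) * (‖p y‖ * Real.exp 1) := by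
    intro b hb
    have h1 := norm_image_sub_le_of_norm_deriv_le_segment_01'
      (f := fun t : ℝ => p (y + t • (b - y))) (fun t ht => hp y hy b hb t ht)
      (C := 2 * (K * ‖b - y‖) * (‖p y‖ * Real.exp 1))
      (fun t ht => by
        have hm := hseg y hy b hb t ⟨ht.1, ht.2.le⟩
        exact (hcomm _ hm _).trans (mul_le_mul_of_nonneg_left (hbdd _ hm) (by positivity)))
    simpa using h1
  have hpc : ContinuousAt p y := by
    rw [ContinuousAt, tendsto_iff_norm_sub_tendsto_zero]
    have h1 : Filter.Tendsto (fun b => 2 * (K * ‖b - y‖) * (‖p y‖ * Real.exp 1)) (nhds y)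
        (nhds 0) := by
      have h2 : Continuous fun b => 2 * (K * ‖b - y‖) * (‖p y‖ * Real.exp 1) := by fun_prop
      simpa using h2.tendsto y
    refine squeeze_zero' (Filter.Eventually.of_forall fun _ => norm_nonneg _) ?_ h1
    filter_upwards [hBo.mem_nhds hy] with b hb using hlip b hb
  have hAc : ContinuousAt A y := hA.continuousAt (hBo.mem_nhds hy)
  have hcc : ContinuousAt (fun z => commL (p z) (A z)) y :=
    (((ContinuousLinearMap.mul ℝ R).continuous.continuousAt.comp hpc).clm_comp hAc).sub
      (((ContinuousLinearMap.mul ℝ R).flip.continuous.continuousAt.comp hpc).clm_comp hAc)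
  rw [hasFDerivAt_iff_isLittleO, Asymptotics.isLittleO_iff]
  intro ε hε
  have hev : ∀ᶠ z in nhds y, ‖commL (p z) (A z) - commL (p y) (A y)‖ < ε ∧ z ∈ B := by
    refine Filter.Eventually.and ?_ (hBo.mem_nhds hy)
    have := (tendsto_iff_norm_sub_tendsto_zero.1 hcc).eventually (gt_mem_nhds hε)
    exact this
  obtain ⟨δ, hδ, hball⟩ := Metric.eventually_nhds_iff_ball.1 hev
  filter_upwards [Metric.ball_mem_nhds y hδ] with b hb
  have hbB := (hball b hb).2
  have hd : ∀ t ∈ Set.Icc (0 : ℝ) 1, HasDerivWithinAt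
      (fun t : ℝ => p (y + t • (b - y)) - t • commL (p y) (A y) (b - y))
      (commL (p (y + t • (b - y))) (A (y + t • (b - y))) (b - y) - commL (p y) (A y) (b - y))
      (Set.Icc 0 1) t := by
    intro t ht
    have h1 := (hasDerivWithinAt_id t (Set.Icc (0 : ℝ) 1)).smul_const (commL (p y) (A y) (b - y))
    simp only [id_eq, one_smul] at h1
    exact (hp y hy b hbB t ht).sub h1
  have h1 := norm_image_sub_le_of_norm_deriv_le_segment_01' hd (C := ε * ‖b - y‖) (fun t ht => by
    have hm : y + t • (b - y) ∈ Metric.ball y δ :=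
      (convex_ball y δ).add_smul_sub_mem (Metric.mem_ball_self hδ) hb ⟨ht.1, ht.2.le⟩
    rw [← _root_.sub_apply]
    exact (ContinuousLinearMap.le_opNorm _ _).trans
      (mul_le_mul_of_nonneg_right (hball _ hm).1.le (norm_nonneg _)))
  simp only [one_smul, add_sub_cancel, zero_smul, add_zero, sub_zero] at h1
  rw [sub_right_comm]
  exact h1

end BanachAlgebra

section Field

variable {n : ℕ} {M : Type*} [TopologicalSpace M]
  [ChartedSpace (EuclideanSpace ℝ (Fin n)) M] [IsManifold (𝓡 n) ∞ M]

/-- An isometry between definite forms is injective, hence bijective in finite dimension. -/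
theorem IsTransportMap.isUnit {g : RiemMetric n M} {c : M} {B : Set (EuclideanSpace ℝ (Fin n))}
    {K : ℝ} (hB : IsSmall g c B K) {a b : EuclideanSpace ℝ (Fin n)} (ha : a ∈ B) (hb : b ∈ B)
    {L : EuclideanSpace ℝ (Fin n) →L[ℝ] EuclideanSpace ℝ (Fin n)} (hL : IsTransportMap g c a b L) :
    IsUnit L := by
  have hinj : Function.Injective L := by
    rw [injective_iff_map_eq_zero]
    intro v hv
    by_contra hne
    have h1 := gramL_pos g (hB.subset ha) hne
    rw [← hL.gramL_eq (fun s hs => hB.subset (hB.segment_mem ha hb hs)), hv, map_zero] at h1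
    exact lt_irrefl _ h1
  rw [ContinuousLinearMap.isUnit_iff_bijective]
  exact ⟨hinj, LinearMap.surjective_of_injective (f := L.toLinearMap) hinj⟩

/-- If the transport maps between points of a small set intertwine the endomorphisms `p y`, then
these commute with the curvature. -/
theorem IsSmall.commute_curvVec {g : RiemMetric n M} {c : M} {B : Set (EuclideanSpace ℝ (Fin n))}
    {K : ℝ} (hB : IsSmall g c B K)
    {p : EuclideanSpace ℝ (Fin n) → (EuclideanSpace ℝ (Fin n) →L[ℝ] EuclideanSpace ℝ (Fin n))}
    (hp : ∀ a ∈ B, ∀ b ∈ B, ∀ L, IsTransportMap g c a b L → p b * L = L * p a)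
    {y : EuclideanSpace ℝ (Fin n)} (hy : y ∈ B) (u v w : EuclideanSpace ℝ (Fin n)) :
    p y (curvVec g c y u v w) = curvVec g c y u v (p y w) := by
  have hline : ∀ a ∈ B, ∀ b ∈ B, ∀ t ∈ Set.Icc (0 : ℝ) 1,
      HasDerivWithinAt (fun t : ℝ => p (a + t • (b - a)))
        (commL (p (a + t • (b - a))) (chrL g c (a + t • (b - a))) (b - a)) (Set.Icc 0 1) t := by
    intro a ha b hb t ht
    obtain ⟨L, Φ, h0, h1, hΦ⟩ := hB.exists_isTransportMap ha hb
    have hT : ∀ t ∈ Set.Icc (0 : ℝ) 1, IsTransportMap g c a (a + t • (b - a)) (Φ t) :=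
      fun t ht => IsTransportMap.restrict h0 hΦ ht
    have hU : ∀ t ∈ Set.Icc (0 : ℝ) 1, IsUnit (Φ t) :=
      fun t ht => (hT t ht).isUnit hB ha (hB.segment_mem ha hb ht)
    -- Along a segment `p` is the conjugate `Φ p(a) Φ⁻¹`; differentiating with `Φ' = -Γ Φ` gives `p'
    -- = pΓ - Γp`.
    have heq : ∀ t ∈ Set.Icc (0 : ℝ) 1,
        p (a + t • (b - a)) = Φ t * p a * Ring.inverse (Φ t) := by
      intro t ht
      rw [← hp a ha _ (hB.segment_mem ha hb ht) _ (hT t ht), mul_assoc,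
        Ring.mul_inverse_cancel _ (hU t ht), mul_one]
    obtain ⟨U, hUt⟩ := hU t ht
    have hinv : HasFDerivAt Ring.inverse
        (-ContinuousLinearMap.mulLeftRight ℝ _ (↑U⁻¹) (↑U⁻¹)) (Φ t) := by
      rw [← hUt]; exact hasFDerivAt_ringInverse (𝕜 := ℝ) U
    have hd := ((hΦ t ht).mul_const (p a)).mul (hinv.comp_hasDerivWithinAt t (hΦ t ht))
    have hd' := hd.congr (fun s hs => heq s hs) (heq t ht)
    convert! hd' using 1
    rw [heq t ht, commL_apply]
    simp only [Function.comp_apply, _root_.neg_apply, ContinuousLinearMap.mulLeftRight_apply,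
      ← hUt, Ring.inverse_unit]
    simp only [neg_mul, mul_neg, neg_neg, mul_assoc, Units.mul_inv, mul_one]
    abel
  have hder : ∀ z ∈ B, HasFDerivAt p (commL (p z) (chrL g c z)) z := fun z hz =>
    hasFDerivAt_of_segments hB.isOpen hB.convex
      ((contDiffOn_chrL g c).continuousOn.mono hB.subset) hB.norm_le hline hB.mul_le hz
  have h := commute_curvature_of_hasFDerivAt (differentiableAt_chrL g (hB.subset hy))
    (Filter.eventually_of_mem (hB.isOpen.mem_nhds hy) hder) u v
  exact congrArg (fun L => L w) h

end Field

/-! ### Invariant subspaces of the restricted holonomy -/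

/-- The orthogonal projection for a positive definite form commutes with the isometries preserving
its range. -/
theorem exists_orthogonal_projection {E : Type*} [NormedAddCommGroup E] [NormedSpace ℝ E]
    [FiniteDimensional ℝ E] (b : E →L[ℝ] E →L[ℝ] ℝ) (hsymm : ∀ x y, b x y = b y x)
    (hpos : ∀ x, x ≠ 0 → 0 < b x x) (V : Submodule ℝ E) :
    ∃ p : E →L[ℝ] E, (∀ x, p x ∈ V) ∧ (∀ x ∈ V, p x = x) ∧
      ∀ P : E →L[ℝ] E, (∀ x y, b (P x) (P y) = b x y) → (∀ x ∈ V, P x ∈ V) → P * p = p * P := by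
  set β : LinearMap.BilinForm ℝ E := LinearMap.mk₂ ℝ (fun x y => b x y) (by simp) (by simp)
    (by simp) (by simp) with hβ
  have hβa : ∀ x y, β x y = b x y := fun x y => rfl
  have hrefl : β.IsRefl := by
    intro x y h
    rw [hβa] at h ⊢
    rw [hsymm, h]
  have hdisj : Disjoint V (β.orthogonal V) := by
    rw [Submodule.disjoint_def]
    intro x hx hx'
    by_contra hne
    have h1 := hpos x hne
    rw [← hβa, hx' x hx] at h1
    exact lt_irrefl _ h1
  have hc : IsCompl V (β.orthogonal V) :=
    (LinearMap.BilinForm.isCompl_orthogonal_iff_disjoint hrefl).2 hdisj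
  refine ⟨LinearMap.toContinuousLinearMap (V.projection (β.orthogonal V) hc), fun x => ?_, fun x hx => ?_,
    fun P hP hPV => ?_⟩
  · exact Submodule.projection_apply_mem hc x
  · exact Submodule.projection_apply_left hc ⟨x, hx⟩
  · have hinj : Function.Injective P := by
      rw [injective_iff_map_eq_zero]
      intro x hx
      by_contra hne
      have h1 := hpos x hne
      rw [← hP, hx, map_zero] at h1
      exact lt_irrefl _ h1
    -- Equality, not just inclusion, is needed for `P` to preserve the orthogonal complement as
    -- well.
    have hmap : V.map P.toLinearMap = V := by
      refine Submodule.eq_of_le_of_finrank_eq ?_ ?_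
      · rintro _ ⟨x, hx, rfl⟩
        exact hPV x hx
      · exact LinearEquiv.finrank_eq (Submodule.equivMapOfInjective P.toLinearMap hinj V).symm
    have hPW : ∀ x ∈ β.orthogonal V, P x ∈ β.orthogonal V := by
      intro x hx v hv
      rw [← hmap] at hv
      obtain ⟨v, hv, rfl⟩ := hv
      exact (hP v x).trans (hx v hv)
    refine ContinuousLinearMap.ext fun x => ?_
    set q : E →ₗ[ℝ] E := V.projection (β.orthogonal V) hc with hq
    have hadd : P x = P (q x) + P (x - q x) := by rw [← map_add]; congr 1; abel
    change P (q x) = q (P x)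
    have h1 : q (P (q x)) = P (q x) := Submodule.projection_apply_left hc
      ⟨P (q x), hPV _ (Submodule.projection_apply_mem hc x)⟩
    have h2 : q (P (x - q x)) = 0 :=
      (Submodule.projection_apply_eq_zero_iff hc).2 (hPW _ (Submodule.sub_projection_mem hc x))
    rw [hadd, map_add, h1, h2, add_zero]

section Holonomy

variable {n : ℕ} {M : Type*} [TopologicalSpace M]
  [ChartedSpace (EuclideanSpace ℝ (Fin n)) M] [IsManifold (𝓡 n) ∞ M]

/-- The restricted holonomy group at `x` has an invariant subspace other than `0` and `T_x M`. -/
def HasInvariantSubspace (g : RiemMetric n M) (x : M) : Prop :=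
  ∃ V : Submodule ℝ (TangentSpace (𝓡 n) x), IsHolonomyInvariant g x V ∧ V ≠ ⊥ ∧ V ≠ ⊤

/-- An endomorphism of coordinate space as a linear map between tangent spaces. -/
def conjCoord (c : M) {B : Set (EuclideanSpace ℝ (Fin n))} (a b : B)
    (L : EuclideanSpace ℝ (Fin n) →L[ℝ] EuclideanSpace ℝ (Fin n)) :
    TangentSpace (𝓡 n) (chartInv c B a) →ₗ[ℝ] TangentSpace (𝓡 n) (chartInv c B b) :=
  (ofCoord c b.1).toLinearMap ∘ₗ L.toLinearMap ∘ₗ (toCoord c (chartInv c B a)).toLinearMap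

theorem IsSmall.conjCoord_isParallelTransport {g : RiemMetric n M} {c : M}
    {B : Set (EuclideanSpace ℝ (Fin n))} {K : ℝ} (hB : IsSmall g c B K) {a b : B}
    {L : EuclideanSpace ℝ (Fin n) →L[ℝ] EuclideanSpace ℝ (Fin n)} (hL : IsTransportMap g c a b L)
    (v : TangentSpace (𝓡 n) (chartInv c B a)) :
    IsParallelTransport g ((segPath hB.convex a b).map (continuous_chartInv hB.subset)) v
      (conjCoord c a b L v) := by
  have h := hB.isParallelTransport hL (toCoord c (chartInv c B a) v)
  have e : ofCoord c a.1 (toCoord c (chartInv c B a) v) = v := ofCoord_toCoord (hB.subset a.2) v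
  rwa [e] at h

theorem IsSmall.hasInvariantSubspace {g : RiemMetric n M} {c : M}
    {B : Set (EuclideanSpace ℝ (Fin n))} {K : ℝ} (hB : IsSmall g c B K) (a b : B)
    (h : HasInvariantSubspace g (chartInv c B a)) : HasInvariantSubspace g (chartInv c B b) := by
  obtain ⟨V, hV, hV0, hV1⟩ := h
  obtain ⟨L, hL⟩ := hB.exists_isTransportMap a.2 b.2
  have hLb := ContinuousLinearMap.isUnit_iff_bijective.1 (hL.isUnit hB a.2 b.2)
  have hof : Function.Bijective (ofCoord c b.1) :=
    ⟨fun x y hxy => by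
      rw [← toCoord_ofCoord (hB.subset b.2) x, hxy, toCoord_ofCoord (hB.subset b.2)],
      fun v => ⟨_, ofCoord_toCoord (hB.subset b.2) v⟩⟩
  have hbij : Function.Bijective (conjCoord c a b L) :=
    hof.comp (hLb.comp (toCoord_bijective (symm_mem_source (hB.subset a.2))))
  refine ⟨V.map (LinearEquiv.ofBijective _ hbij).toLinearMap,
    hV.map ((segPath hB.convex a b).map (continuous_chartInv hB.subset)) _
      fun v => hB.conjCoord_isParallelTransport hL v, fun h0 => hV0 ?_, fun h1 => hV1 ?_⟩
  · exact Submodule.map_eq_bot_iff.1 h0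
  · exact Submodule.map_eq_top_iff.1 h1

/-- Transport along segments makes the property locally constant, so its locus is clopen. -/
theorem hasInvariantSubspace_of_connected [ConnectedSpace M] {g : RiemMetric n M} {x : M}
    (hx : HasInvariantSubspace g x) (y : M) : HasInvariantSubspace g y := by
  have hnhds : ∀ c : M, ∃ U ∈ nhds c, ∀ q ∈ U,
      (HasInvariantSubspace g q ↔ HasInvariantSubspace g c) := by
    intro c
    obtain ⟨B, K, hB, hc⟩ := exists_isSmall g c
    have hpt : ∀ q ∈ (extChartAt (𝓡 n) c).source, ∀ hq : extChartAt (𝓡 n) c q ∈ B,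
        chartInv c B ⟨extChartAt (𝓡 n) c q, hq⟩ = q := fun q hqs hq =>
      (extChartAt (𝓡 n) c).left_inv hqs
    refine ⟨(extChartAt (𝓡 n) c).source ∩ extChartAt (𝓡 n) c ⁻¹' B,
      Filter.inter_mem (extChartAt_source_mem_nhds c)
        ((continuousAt_extChartAt c).preimage_mem_nhds (hB.isOpen.mem_nhds hc)), ?_⟩
    rintro q ⟨hqs, hq⟩
    have e1 := hpt q hqs hq
    have e2 := hpt c (mem_extChartAt_source c) hc
    constructor
    · intro h
      rw [← e1] at h
      have := hB.hasInvariantSubspace _ ⟨_, hc⟩ h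
      rwa [e2] at this
    · intro h
      rw [← e2] at h
      have := hB.hasInvariantSubspace _ ⟨_, hq⟩ h
      rwa [e1] at this
  have hclopen : IsClopen {q : M | HasInvariantSubspace g q} := by
    refine ⟨⟨?_⟩, ?_⟩
    · rw [isOpen_iff_mem_nhds]
      intro c hc
      obtain ⟨U, hU, h⟩ := hnhds c
      exact Filter.mem_of_superset hU fun q hq hq' => hc ((h q hq).1 hq')
    · rw [isOpen_iff_mem_nhds]
      intro c hc
      obtain ⟨U, hU, h⟩ := hnhds c
      exact Filter.mem_of_superset hU fun q hq => (h q hq).2 hc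
  have huniv := hclopen.eq_univ ⟨x, hx⟩
  have hy : y ∈ {q : M | HasInvariantSubspace g q} := by
    rw [huniv]
    trivial
  exact hy

/-- `P` is the transport around the triangle `a → y → z → a`, which is null-homotopic because its
coordinate image lies in a convex set. -/
theorem IsSmall.conj_mem_restrictedHolonomy {g : RiemMetric n M} {c : M}
    {B : Set (EuclideanSpace ℝ (Fin n))} {K : ℝ} (hB : IsSmall g c B K) {a y z : B}
    {S T L P : EuclideanSpace ℝ (Fin n) →L[ℝ] EuclideanSpace ℝ (Fin n)}
    (hS : IsTransportMap g c a y S) (hT : IsTransportMap g c a z T) (hL : IsTransportMap g c y z L)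
    (hP : T * P = L * S) : conjCoord c a a P ∈ restrictedHolonomy g (chartInv c B a) := by
  have : ContractibleSpace B := hB.convex.contractibleSpace ⟨a.1, a.2⟩
  refine ⟨(((segPath hB.convex a y).trans (segPath hB.convex y z)).trans
    (segPath hB.convex a z).symm).map (continuous_chartInv hB.subset), ?_, fun v => ?_⟩
  · exact Path.Homotopic.map (SimplyConnectedSpace.paths_homotopic _ (Path.refl a))
      ⟨_, continuous_chartInv hB.subset⟩
  · rw [Path.map_trans, Path.map_trans, ← Path.map_symm]
    have h1 := (hB.conjCoord_isParallelTransport hS v).trans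
      (hB.conjCoord_isParallelTransport hL _)
    have h2 := (hB.conjCoord_isParallelTransport hT (conjCoord c a a P v)).symm
    have e : conjCoord c y z L (conjCoord c a y S v) = conjCoord c a z T (conjCoord c a a P v) := by
      have e1 : toCoord c (chartInv c B y) (ofCoord c y.1 (S (toCoord c (chartInv c B a) v)))
          = S (toCoord c (chartInv c B a) v) := toCoord_ofCoord (hB.subset y.2) _
      have e2 : toCoord c (chartInv c B a) (ofCoord c a.1 (P (toCoord c (chartInv c B a) v)))
          = P (toCoord c (chartInv c B a) v) := toCoord_ofCoord (hB.subset a.2) _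
      exact (congrArg (fun w => ofCoord c z.1 (L w)) e1).trans
        ((congrArg (fun Q => ofCoord c z.1 (Q (toCoord c (chartInv c B a) v))) hP.symm).trans
          (congrArg (fun w => ofCoord c z.1 (T w)) e2).symm)
    rw [e] at h1
    exact h1.trans h2

/-- Carry the orthogonal projection `p` onto the invariant subspace radially from `a`. Holonomy
invariance makes the resulting field parallel along all segments, so it commutes with the curvature,
which therefore preserves its range. -/
theorem IsSmall.exists_curvVec_invariant {g : RiemMetric n M} {c : M}
    {B : Set (EuclideanSpace ℝ (Fin n))} {K : ℝ} (hB : IsSmall g c B K) (a : B)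
    (h : HasInvariantSubspace g (chartInv c B a)) {y : EuclideanSpace ℝ (Fin n)} (hy : y ∈ B) :
    ∃ V : Submodule ℝ (EuclideanSpace ℝ (Fin n)), V ≠ ⊥ ∧ V ≠ ⊤ ∧
      ∀ u v, ∀ w ∈ V, curvVec g c y u v w ∈ V := by
  obtain ⟨V, hV, hV0, hV1⟩ := h
  set e : TangentSpace (𝓡 n) (chartInv c B a) ≃ₗ[ℝ] EuclideanSpace ℝ (Fin n) :=
    LinearEquiv.ofBijective (toCoord c (chartInv c B a)).toLinearMap
      (toCoord_bijective (symm_mem_source (hB.subset a.2))) with he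
  have he' : ∀ x, e (ofCoord c a.1 x) = x := fun x => toCoord_ofCoord (hB.subset a.2) x
  obtain ⟨p, hp1, hp2, hp3⟩ := exists_orthogonal_projection (gramL g c a.1) (gramL_symm g c a.1)
    (fun x hx => gramL_pos g (hB.subset a.2) hx) (V.map e.toLinearMap)
  -- The transport from `a` is made a total function of the end point, with the irrelevant value 0
  -- outside `B`.
  have hex : ∀ z : EuclideanSpace ℝ (Fin n), ∃ T, z ∈ B → IsTransportMap g c a.1 z T := by
    intro z
    by_cases hz : z ∈ B
    · exact (hB.exists_isTransportMap a.2 hz).imp fun T hT _ => hT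
    · exact ⟨0, fun h => absurd h hz⟩
  choose T hT using hex
  have hTu : ∀ z ∈ B, IsUnit (T z) := fun z hz => (hT z hz).isUnit hB a.2 hz
  have hseg : ∀ x ∈ B, ∀ z ∈ B, ∀ s ∈ Set.Icc (0 : ℝ) 1,
      x + s • (z - x) ∈ (extChartAt (𝓡 n) c).target :=
    fun x hx z hz s hs => hB.subset (hB.segment_mem hx hz hs)
  have hcomm : ∀ x ∈ B, ∀ z ∈ B, ∀ L, IsTransportMap g c x z L →
      (T z * p * Ring.inverse (T z)) * L = L * (T x * p * Ring.inverse (T x)) := by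
    intro x hx z hz L hL
    -- The holonomy of the triangle `a → x → z → a`: it is an isometry preserving the subspace, so
    -- it commutes with `p`.
    set P := Ring.inverse (T z) * (L * T x) with hPdef
    have hTP : T z * P = L * T x := by
      rw [hPdef, ← mul_assoc, Ring.mul_inverse_cancel _ (hTu z hz), one_mul]
    have hTP' : ∀ w, T z (P w) = L (T x w) := fun w => congrArg (fun Q => Q w) hTP
    have hPp := hp3 P (fun w w' => by
      rw [← (hT z hz).gramL_eq (hseg _ a.2 _ hz), hTP', hTP', hL.gramL_eq (hseg _ hx _ hz),
        (hT x hx).gramL_eq (hseg _ a.2 _ hx)]) (by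
      rintro _ ⟨w, hw, rfl⟩
      have hmem := hB.conj_mem_restrictedHolonomy (a := a) (y := ⟨x, hx⟩) (z := ⟨z, hz⟩)
        (hT x hx) (hT z hz) hL hTP
      exact ⟨_, hV _ hmem w hw, he' _⟩)
    have h1 : Ring.inverse (T z) * L = P * Ring.inverse (T x) := by
      rw [hPdef, mul_assoc, mul_assoc, Ring.mul_inverse_cancel _ (hTu x hx), mul_one]
    calc (T z * p * Ring.inverse (T z)) * L = T z * (p * P) * Ring.inverse (T x) := by
          rw [mul_assoc, h1]; simp only [mul_assoc]
      _ = (T z * P) * p * Ring.inverse (T x) := by rw [← hPp]; simp only [mul_assoc]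
      _ = _ := by rw [hTP]; simp only [mul_assoc]
  have hinv : ∀ w, Ring.inverse (T y) (T y w) = w := fun w =>
    congrArg (fun Q => Q w) (Ring.inverse_mul_cancel _ (hTu y hy))
  have hcurv := fun u v w => hB.commute_curvVec
    (p := fun z => T z * p * Ring.inverse (T z)) hcomm hy u v w
  -- This range is the image of the invariant subspace under the isomorphism `T y`, so it is proper
  -- and nonzero.
  refine ⟨LinearMap.range (T y * p * Ring.inverse (T y)).toLinearMap, fun h0 => hV0 ?_,
    fun h1 => hV1 ?_, ?_⟩
  · rw [LinearMap.range_eq_bot] at h0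
    rw [Submodule.eq_bot_iff]
    intro x hx
    have h2 : T y (p (Ring.inverse (T y) (T y (e x)))) = 0 :=
      congrArg (fun Q : _ →ₗ[ℝ] _ => Q (T y (e x))) h0
    rw [hinv, hp2 (e x) ⟨x, hx, rfl⟩] at h2
    have h3 := hinv (e x)
    rw [h2, map_zero] at h3
    exact e.map_eq_zero_iff.1 h3.symm
  · rw [Submodule.eq_top_iff']
    intro x
    obtain ⟨w, hw⟩ : T y (e x) ∈ LinearMap.range (T y * p * Ring.inverse (T y)).toLinearMap :=
      h1 ▸ Submodule.mem_top
    have h2 : T y (p (Ring.inverse (T y) w)) = T y (e x) := hw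
    have h3 := congrArg (fun w => (Ring.inverse (T y)) w) h2
    beta_reduce at h3
    rw [hinv, hinv] at h3
    obtain ⟨x', hx', h4⟩ := hp1 (Ring.inverse (T y) w)
    rw [h3] at h4
    rwa [← e.injective h4]
  · rintro u v _ ⟨w, rfl⟩
    exact ⟨curvVec g c y u v w, hcurv u v w⟩

end Holonomy

/-! ### Curvature and holonomy -/

/-- What the projection removes, the skew part and a multiple of the identity, is orthogonal to
`Sym0 n`. Hence the projected operator and `rBar` have the same quadratic form there. -/
theorem frob_proj0 {n : ℕ} (B : Matrix (Fin n) (Fin n) ℝ) {A : Matrix (Fin n) (Fin n) ℝ}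
    (hA : A ∈ Sym0 n) : frob (proj0 n B) A = frob B A := by
  obtain ⟨hs, ht⟩ := hA
  have h1 : frob Bᵀ A = frob B A := by
    simp only [frob, Matrix.transpose_apply]
    rw [Finset.sum_comm]
    refine Finset.sum_congr rfl fun i _ => Finset.sum_congr rfl fun j _ => ?_
    rw [← hs, Matrix.transpose_apply, hs]
  have h2 : frob (1 : Matrix (Fin n) (Fin n) ℝ) A = 0 := by
    simpa [frob, Matrix.one_apply, Matrix.trace] using ht
  have h3 : frob (proj0 n B) A = (1 / 2 : ℝ) * (frob B A + frob Bᵀ A)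
      - B.trace / n * frob (1 : Matrix (Fin n) (Fin n) ℝ) A := by
    simp only [frob, proj0, Matrix.sub_apply, Matrix.smul_apply, Matrix.add_apply, smul_eq_mul,
      Finset.mul_sum, ← Finset.sum_add_distrib, ← Finset.sum_sub_distrib]
    refine Finset.sum_congr rfl fun i _ => Finset.sum_congr rfl fun j _ => ?_
    ring
  rw [h3, h1, h2]
  ring

theorem quad_map {n : ℕ} (r : Fin n → Fin n → Fin n → Fin n → ℝ)
    (L : EuclideanSpace ℝ (Fin n) →ₗ[ℝ] EuclideanSpace ℝ (Fin n))
    (a b c d : EuclideanSpace ℝ (Fin n)) :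
    quad r (L a) (L b) (L c) (L d) = quad (fun i j k l =>
      quad r (L (EuclideanSpace.single i 1)) (L (EuclideanSpace.single j 1))
        (L (EuclideanSpace.single k 1)) (L (EuclideanSpace.single l 1))) a b c d :=
  eq_quad_of_isLinearMap (f := fun a b c d => quad r (L a) (L b) (L c) (L d))
    (fun _ _ _ => ⟨fun x y => by rw [map_add, quad_add_fst],
      fun s x => by rw [map_smul, quad_smul_fst, smul_eq_mul]⟩)
    (fun _ _ _ => ⟨fun x y => by rw [map_add, quad_add_snd],
      fun s x => by rw [map_smul, quad_smul_snd, smul_eq_mul]⟩)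
    (fun _ _ _ => ⟨fun x y => by rw [map_add, quad_add_trd],
      fun s x => by rw [map_smul, quad_smul_trd, smul_eq_mul]⟩)
    (fun _ _ _ => ⟨fun x y => by rw [map_add, quad_add_fth],
      fun s x => by rw [map_smul, quad_smul_fth, smul_eq_mul]⟩) a b c d

theorem quad_neg {n : ℕ} (r : Fin n → Fin n → Fin n → Fin n → ℝ)
    (a b c d : EuclideanSpace ℝ (Fin n)) :
    quad (fun i j k l => -r i j k l) a b c d = -quad r a b c d := by
  simp only [quad, neg_mul, Finset.sum_neg_distrib]

theorem IsAlgCurv.quad_comp {n : ℕ} {r : Fin n → Fin n → Fin n → Fin n → ℝ} (h : IsAlgCurv r)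
    (u : Fin n → EuclideanSpace ℝ (Fin n)) :
    IsAlgCurv fun i j k l => quad r (u i) (u j) (u k) (u l) where
  anti_left _ _ _ _ := h.quad_anti_left _ _ _ _
  anti_right _ _ _ _ := h.quad_anti_right _ _ _ _
  bianchi _ _ _ _ := h.quad_bianchi _ _ _ _

section Frame

variable {n : ℕ} {M : Type*} [TopologicalSpace M]
  [ChartedSpace (EuclideanSpace ℝ (Fin n)) M] [IsManifold (𝓡 n) ∞ M]

theorem frob_curvOpII (g : RiemMetric n M) (x : M) (e : Fin n → TangentSpace (𝓡 n) x)
    (A : Sym0 n) : frob (curvOpII g x e A).1 A.1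
      = rForm (fun i j k l => riemannTensor g x (e i) (e j) (e k) (e l)) A.1 :=
  frob_proj0 _ A.2

/-- The chart coordinates of the vector with given components in the frame `e`. -/
def frameCoord (x : M) (e : Fin n → TangentSpace (𝓡 n) x) :
    EuclideanSpace ℝ (Fin n) →ₗ[ℝ] EuclideanSpace ℝ (Fin n) where
  toFun a := ∑ i, a i • toCoord x x (e i)
  map_add' a b := by simp [add_smul, Finset.sum_add_distrib]
  map_smul' s a := by simp [mul_smul, Finset.smul_sum]

theorem frameCoord_single (x : M) (e : Fin n → TangentSpace (𝓡 n) x) (i : Fin n) :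
    frameCoord x e (EuclideanSpace.single i 1) = toCoord x x (e i) := by
  simp [frameCoord, ite_smul]

theorem IsOrthonormalFrame.gramL_frameCoord {g : RiemMetric n M} {x : M}
    {e : Fin n → TangentSpace (𝓡 n) x} (he : IsOrthonormalFrame g x e)
    (a b : EuclideanSpace ℝ (Fin n)) :
    gramL g x (extChartAt (𝓡 n) x x) (frameCoord x e a) (frameCoord x e b) = inner ℝ a b := by
  have h : ∀ i j, gramL g x (extChartAt (𝓡 n) x x) (toCoord x x (e i)) (toCoord x x (e j))
      = if i = j then 1 else 0 := fun i j => by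
    rw [gramL_toCoord g (ChartedSpace.mem_chart_source x), he i j]
  simp only [frameCoord, LinearMap.coe_mk, AddHom.coe_mk, map_sum, map_smul,
    sum_apply, smul_apply, h, smul_eq_mul]
  simp [PiLp.inner_apply, mul_comm]

theorem IsOrthonormalFrame.frameCoord_bijective {g : RiemMetric n M} {x : M}
    {e : Fin n → TangentSpace (𝓡 n) x} (he : IsOrthonormalFrame g x e) :
    Function.Bijective (frameCoord x e) := by
  have hinj : Function.Injective (frameCoord x e) := by
    rw [injective_iff_map_eq_zero]
    intro a ha
    have := he.gramL_frameCoord a a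
    rw [ha, map_zero] at this
    exact inner_self_eq_zero.1 this.symm
  exact ⟨hinj, LinearMap.injective_iff_surjective.1 hinj⟩

/-- The frame identifies the metric at `x` with the standard inner product, which reduces the claim
to the algebraic statement about components. -/
theorem riemannTensor_eq_zero_of_curvVec_invariant {g : RiemMetric n M} {x : M}
    {e : Fin n → TangentSpace (𝓡 n) x} (he : IsOrthonormalFrame g x e)
    (hT : IsKNonneg n (curvOpII g x e) ∨ IsKNonneg n (-curvOpII g x e))
    {V : Submodule ℝ (EuclideanSpace ℝ (Fin n))} (hV0 : V ≠ ⊥) (hV1 : V ≠ ⊤)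
    (hV : ∀ u v, ∀ w ∈ V, curvVec g x (extChartAt (𝓡 n) x x) u v w ∈ V)
    (u v w z : TangentSpace (𝓡 n) x) : riemannTensor g x u v w z = 0 := by
  have hx := mem_extChartAt_target (I := 𝓡 n) x
  set R := fun i j k l => curvLow g x i j k l (extChartAt (𝓡 n) x x) with hR
  have hRalg : IsAlgCurv R := isAlgCurv_curvLow g hx
  set L := frameCoord x e with hL
  have hbij : Function.Bijective L := he.frameCoord_bijective
  set r := fun i j k l => riemannTensor g x (e i) (e j) (e k) (e l) with hr
  have hrq : r = fun i j k l => quad R (L (EuclideanSpace.single i 1))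
      (L (EuclideanSpace.single j 1)) (L (EuclideanSpace.single k 1))
      (L (EuclideanSpace.single l 1)) := by
    funext i j k l
    simp only [hL, frameCoord_single]
    exact riemannTensor_eq_quad g x (e i) (e j) (e k) (e l)
  have halg : IsAlgCurv r := hrq ▸ hRalg.quad_comp fun i => L (EuclideanSpace.single i 1)
  have hquad : ∀ a b c d, quad r a b c d = quad R (L a) (L b) (L c) (L d) := fun a b c d => by
    rw [hrq, ← quad_map]
  have hW0 : V.comap L ≠ ⊥ := fun h => hV0 (by
    rw [← Submodule.map_comap_eq_of_surjective hbij.2 V, h, Submodule.map_bot])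
  have hW1 : V.comap L ≠ ⊤ := fun h => hV1 (by
    rw [← Submodule.map_comap_eq_of_surjective hbij.2 V, h, Submodule.map_top,
      LinearMap.range_eq_top.2 hbij.2])
  -- The fourth argument is the one acted on: the curvature keeps `L a` in `V`, and `b` is
  -- orthogonal to the preimage of `V`.
  have hW : ∀ a ∈ V.comap L, ∀ b ∈ (V.comap L)ᗮ, ∀ p q, quad r p q b a = 0 := by
    intro a ha b hb p q
    obtain ⟨a', ha'⟩ := hbij.2 (curvVec g x (extChartAt (𝓡 n) x x) (L p) (L q) (L a))
    rw [hquad, quad_curvLow g hx, ← ha', he.gramL_frameCoord]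
    refine Submodule.inner_left_of_mem_orthogonal (K := V.comap L) ?_ hb
    rw [Submodule.mem_comap, ha']
    exact hV _ _ _ ha
  have hzero : ∀ i j k l, r i j k l = 0 := by
    rcases hT with hT | hT
    · exact halg.eq_zero_of_reducible hT (frob_curvOpII g x e) _ hW0 hW1 hW
    · intro i j k l
      -- The negated operator belongs to the negated tensor, which has the same symmetries and the
      -- same vanishing mixed components.
      refine neg_eq_zero.1 (halg.neg.eq_zero_of_reducible hT (fun A => ?_) _ hW0 hW1
        (fun a ha b hb p q => by rw [quad_neg, hW a ha b hb, neg_zero]) i j k l)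
      have h1 : frob ((-curvOpII g x e) A).1 A.1 = -frob (curvOpII g x e A).1 A.1 := by
        simp [frob]
      rw [h1, frob_curvOpII]
      simp [rForm, hr]
  obtain ⟨a, ha⟩ := hbij.2 (toCoord x x u)
  obtain ⟨b, hb⟩ := hbij.2 (toCoord x x v)
  obtain ⟨c, hc⟩ := hbij.2 (toCoord x x w)
  obtain ⟨d, hd⟩ := hbij.2 (toCoord x x z)
  rw [riemannTensor_eq_quad, ← ha, ← hb, ← hc, ← hd, ← hquad]
  simp [quad, hzero]

theorem isFlat_of_hasInvariantSubspace [ConnectedSpace M] {g : RiemMetric n M}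
    (h : CurvIINonneg g n ∨ CurvIINonpos g n) {x : M} (hx : HasInvariantSubspace g x) :
    IsFlat g := by
  intro c
  obtain ⟨e, he, hT⟩ : ∃ e : Fin n → TangentSpace (𝓡 n) c, IsOrthonormalFrame g c e ∧
      (IsKNonneg n (curvOpII g c e) ∨ IsKNonneg n (-curvOpII g c e)) := by
    rcases h with h | h
    · obtain ⟨e, he, hT⟩ := h c
      exact ⟨e, he, Or.inl hT⟩
    · obtain ⟨e, he, hT⟩ := h c
      exact ⟨e, he, Or.inr hT⟩
  obtain ⟨B, K, hB, hc⟩ := exists_isSmall g c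
  have e1 : chartInv c B ⟨extChartAt (𝓡 n) c c, hc⟩ = c :=
    (extChartAt (𝓡 n) c).left_inv (mem_extChartAt_source c)
  have hinv := hasInvariantSubspace_of_connected hx (chartInv c B ⟨extChartAt (𝓡 n) c c, hc⟩)
  obtain ⟨V, hV0, hV1, hV⟩ := hB.exists_curvVec_invariant _ hinv hc
  exact riemannTensor_eq_zero_of_curvVec_invariant he hT hV0 hV1 hV

end Frame

end CurvII

end

/-! ### The dichotomy between irreducible and flat -/

theorem mainTheorem4 (n : ℕ) (M : Type*) [TopologicalSpace M] [T2Space M]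
    [SecondCountableTopology M] [ConnectedSpace M]
    [ChartedSpace (EuclideanSpace ℝ (Fin n)) M] [IsManifold (𝓡 n) ∞ M]
    (g : CurvII.RiemMetric n M)
    (h : CurvII.CurvIINonneg g n ∨ CurvII.CurvIINonpos g n) :
    CurvII.IsIrreducible g ∨ CurvII.IsFlat g := by
  rw [or_iff_not_imp_left]
  intro hirr
  -- In dimension 0 the tangent spaces are trivial, hence not irreducible, but the curvature is an
  -- empty sum. For `n ≥ 1` nontriviality is automatic, so failure of irreducibility produces a
  -- proper nonzero invariant subspace.
  rcases Nat.eq_zero_or_pos n with rfl | hn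
  · intro x u v w z
    simp [CurvII.riemannTensor]
  · simp only [CurvII.IsIrreducible, not_forall] at hirr
    obtain ⟨x, hx⟩ := hirr
    have : Nonempty (Fin n) := ⟨⟨0, hn⟩⟩
    have hnt : Nontrivial (TangentSpace (𝓡 n) x) :=
      inferInstanceAs (Nontrivial (EuclideanSpace ℝ (Fin n)))
    simp only [hnt, true_and, not_forall, not_or] at hx
    obtain ⟨V, hV, hV0, hV1⟩ := hx
    exact CurvII.isFlat_of_hasInvariantSubspace h (x := x) ⟨V, hV, hV0, hV1⟩
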